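/- For an integer $N\ge 1$ let $\varepsilon=1/N$ and $\Lambda_N=\{-N,\dots,N\}$. **Marks.** Under $\mathbf P_\varepsilon$ the pairs $\{b,b+1\}$, $b\in\mathbb Z$, carry mutually independent Poisson point processes on $(0,\infty)$ of intensity $\varepsilon^{-2}$; their points are called marks, and each mark is independently active or passive with probability $1/2$. **Coupling.** Let $n$ be a positive integer and let $\sigma$ be a permutation of $\{1,\dots,n\}$ (the priority list); particle $i$ has priority over particle $j$ if $\sigma(i)<\sigma(j)$. Given $\underline x(0),\underline x^0(0)\in\Lambda_N^n$, where the $x_i(0)$ are distinct, the processes $\underline x(t)=(x_1(t),\dots,x_n(t))$ (stirring particles) and $\underline x^0(t)=(x^0_1(t),\dots,x^0_n(t))$ (independent particles) in $\Lambda_N^n$ are constant between marks and change as follows when a mark appears at a pair $\{b,b+1\}$; positions on the right-hand sides and in the conditions are those just before the mark. * If the mark is active and $b,b+1\in\Lambda_N$, the stirring particles at $b$ and $b+1$ (if any) exchange sites, i.e. a particle at one of the two sites moves to the other one. Otherwise $\underline x$ does not change. * If $x_i\notin\{b,b+1\}$, then $x^0_i$ does not change. If $x_i\in\{b,b+1\}$,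 let $v$ be the other site of the pair. If $v$ is occupied by a stirring particle $x_j$ having priority over $i$, then $x_i^0$ attempts the jump $x^0_i\to x^0_i+(v-x_i)$ if and only if the mark is passive. In all other cases ($v$ is empty, or $v\notin\Lambda_N$, or $v$ is occupied by a particle over which $i$ has priority) $x_i^0$ attempts this jump if and only if the mark is active. Attempted jumps that lead out of $\Lambda_N$ are suppressed. **Theorem.** For every $n\ge 1$, $T>0$, $\zeta>0$ and $k\in\mathbb N$ there is a constant $c$ (depending only on $n,T,\zeta,k$) such that for every $N\ge1$ with $\varepsilon=1/N$, every priority list $\sigma$, all initial positions $\underline x(0)=\underline x^0(0)\in\Lambda_N^n$ with distinct coordinates, every $\ell\in\{1,\dots,n\}$ and every $t\in(0,T]$, $$\mathbf P_\varepsilon\Big[\,|x_\ell(t)-x^0_\ell(t)|\ \ge\ (\varepsilon^{-2}t)^{1/4+\zeta}\Big]\ \le\ c\,(\varepsilon^{-2}t)^{-k}.$$ -/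

import Mathlib

open MeasureTheory ProbabilityTheory

/-! ### The active/passive marks process -/

/-- Sample space of the marks. The pair of sites `{b, b + 1}` is indexed by `b : ℤ`. The entry
`ω (b, m)` consists of the waiting time between the mark number `m - 1` (time `0` if `m = 0`) and
the mark number `m` at the pair `{b, b + 1}`, and of the attribute of the mark number `m`
(`true`: active, `false`: passive). -/
abbrev MarkSpace : Type := ℤ × ℕ → ℝ × Bool

/-- Law of the marks: the pairs `{b, b + 1}`, `b ∈ ℤ`, carry mutually independent Poisson
processes of intensity `r` (i.i.d. exponential waiting times of rate `r`), and each mark is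
independently active or passive with probability `1 / 2`. -/
noncomputable def marksLaw (r : ℝ) : Measure MarkSpace :=
  Measure.infinitePi fun _ : ℤ × ℕ =>
    (expMeasure r).prod (PMF.uniformOfFintype Bool).toMeasure

theorem isProbabilityMeasure_marksLaw {r : ℝ} (hr : 0 < r) :
    IsProbabilityMeasure (marksLaw r) := by
  have := isProbabilityMeasure_expMeasure hr
  unfold marksLaw
  infer_instance

/-- The time of the mark number `p.2` (counted from `0`) at the pair `{p.1, p.1 + 1}`. -/
def markTime (ω : MarkSpace) (p : ℤ × ℕ) : ℝ :=
  ∑ i ∈ Finset.range (p.2 + 1), (ω (p.1, i)).1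

/-- The marks up to time `t` at the pairs `{b, b + 1}` that intersect `Λ_N = {-N, …, N}`. -/
def marksUpTo (N : ℕ) (ω : MarkSpace) (t : ℝ) : Set (ℤ × ℕ) :=
  {p | -(N : ℤ) - 1 ≤ p.1 ∧ p.1 ≤ N ∧ markTime ω p ≤ t}

open Classical in
/-- The marks of `marksUpTo N ω t` in chronological order, each one given as the index `b` of its
pair `{b, b + 1}` together with its attribute. With probability one there are finitely many of
them, at distinct times (the value `[]` in the other case is irrelevant). -/
noncomputable def chronologicalMarks (N : ℕ) (ω : MarkSpace) (t : ℝ) : List (ℤ × Bool) :=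
  if h : (marksUpTo N ω t).Finite then
    (h.toFinset.toList.mergeSort fun p q => decide (markTime ω p ≤ markTime ω q)).map
      fun p => (p.1, (ω p).2)
  else []

/-! ### The effect of a single mark on stirring and on independent particles -/

/-- Effect of a mark at `{b, b + 1}` on the stirring particles: if the mark is active and both
`b` and `b + 1` are in `Λ_N`, then the contents of `b` and `b + 1` are exchanged. -/
def stirringStep (N : ℕ) {n : ℕ} (b : ℤ) (active : Bool) (x : Fin n → ℤ) : Fin n → ℤ :=
  if active = true ∧ -(N : ℤ) ≤ b ∧ b + 1 ≤ N then fun i => Equiv.swap b (b + 1) (x i) else x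

/-- Jump attempted by the `i`-th independent particle because of a mark at `{b, b + 1}`, when the
stirring particles are at `x` just before the mark. Particle `i` attempts a jump only if its
stirring partner is at `b` or `b + 1`, and the attempted jump is then directed from the position of
that partner to the other site of the pair. If the other site is occupied by a stirring particle
with priority over `i`, the jump is attempted iff the mark is passive; if the other site is empty,
outside `Λ_N`, or occupied by a stirring particle over which `i` has priority, the jump is
attempted iff the mark is active. -/
def attemptedJump {n : ℕ} (σ : Equiv.Perm (Fin n)) (b : ℤ) (active : Bool) (x : Fin n → ℤ)
    (i : Fin n) : ℤ :=
  if x i = b then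
    if ∃ j, x j = b + 1 ∧ σ j < σ i then
      if active = false then 1 else 0
    else
      if active = true then 1 else 0
  else if x i = b + 1 then
    if ∃ j, x j = b ∧ σ j < σ i then
      if active = false then -1 else 0
    else
      if active = true then -1 else 0
  else 0

/-- Effect of a mark at `{b, b + 1}` on the independent particles at `z`, when the stirring
particles are at `x` just before the mark: the attempted jump is performed unless it leads out
of `Λ_N`. -/
def independentStep (N : ℕ) {n : ℕ} (σ : Equiv.Perm (Fin n)) (b : ℤ) (active : Bool)
    (x z : Fin n → ℤ) : Fin n → ℤ :=
  let y : Fin n → ℤ := fun i => z i + attemptedJump σ b active x i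
  if ∀ i, -(N : ℤ) ≤ y i ∧ y i ≤ N then y else z

/-- Effect of a mark on the pair (stirring particles, independent particles). -/
def couplingStep (N : ℕ) {n : ℕ} (σ : Equiv.Perm (Fin n))
    (c : (Fin n → ℤ) × (Fin n → ℤ)) (mark : ℤ × Bool) : (Fin n → ℤ) × (Fin n → ℤ) :=
  (stirringStep N mark.1 mark.2 c.1, independentStep N σ mark.1 mark.2 c.1 c.2)

/-! ### The coupled processes -/

/-- State at time `t` of the coupled process which starts from the stirring configuration `x` and
the independent configuration `z`: the marks up to time `t` are applied in chronological order. -/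
noncomputable def coupledProcess (N : ℕ) {n : ℕ} (σ : Equiv.Perm (Fin n)) (x z : Fin n → ℤ)
    (ω : MarkSpace) (t : ℝ) : (Fin n → ℤ) × (Fin n → ℤ) :=
  (chronologicalMarks N ω t).foldl (couplingStep N σ) (x, z)

/-- The labeled stirring particles `x(t)` of the coupled process. -/
noncomputable def stirringPosition (N : ℕ) {n : ℕ} (σ : Equiv.Perm (Fin n)) (x z : Fin n → ℤ)
    (ω : MarkSpace) (t : ℝ) : Fin n → ℤ :=
  (coupledProcess N σ x z ω t).1

/-- The independent particles `x⁰(t)` of the coupled process. -/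
noncomputable def independentPosition (N : ℕ) {n : ℕ} (σ : Equiv.Perm (Fin n)) (x z : Fin n → ℤ)
    (ω : MarkSpace) (t : ℝ) : Fin n → ℤ :=
  (coupledProcess N σ x z ω t).2

/-! Let D be the gap between the `ℓ`-th stirring and the `ℓ`-th independent particle, and M = ε⁻²t.
Only a collision, a mark at a pair holding the stirring particle `ℓ` and one with priority over it,
can increase |D|. There the stirring particle moves if the mark is active and the independent one
tries to move if it is passive, so D makes a fair ±1 step, up to suppressions at the walls that help
(`abs_discrepancy_le_of_collides`, `abs_discrepancy_le_of_not_collides`). The number of collisions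
is governed by the local time of stirring pairs at distance one, which is of order √M; hence |D| is
of order M^(1/4).

The local time is controlled by `potential`, U = ∑ (|x_i - x_j| - (x_i² + x_j²)/N) over all i, j.
Its drift is at least twice the number of neighbouring pairs minus 4n²/N, the quadratic terms making
up for the walls. In `lyapunov`, cosh(λD) exp(-αU) with λ² = α, a collision costs a factor cosh λ ≤
1 + α on average and leaves U unchanged, and the drift of U pays for it (`sum_letters_lyapunov_le`).
For α of order M^(-1/2) the remaining growth up to time t is bounded. A gap M^(1/4+ζ) makes this
function exceed its initial value by a factor exponentially large in M^ζ, unless U has moved a lot;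
then some stirring particle has travelled far, which `sum_letters_cosh_le` makes unlikely.

Probability enters only through an upper bound: a given list of m marks has probability at most that
of a Poisson number of independent uniform marks (`marksLaw_chronologicalMarks_eq_le`). One-step
sums over all possible marks are iterated along lists and summed against these weights, which gives
the Markov inequality `marksLaw_le_foldl_le` without any continuous-time martingale. -/

/-! ### Resampling and exponential waiting times -/

/-- Resampling one coordinate does not change a product of probability measures. -/
theorem map_update_infinitePi {ι : Type*} [DecidableEq ι] {X : ι → Type*}
    [∀ i, MeasurableSpace (X i)] (μ : ∀ i, Measure (X i)) [∀ i, IsProbabilityMeasure (μ i)] (i : ι) :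
    ((Measure.infinitePi μ).prod (μ i)).map (fun p => Function.update p.1 i p.2)
      = Measure.infinitePi μ := by
  have hmeas : Measurable fun p : (∀ j, X j) × X i => Function.update p.1 i p.2 := by
    refine measurable_pi_lambda _ fun j => ?_
    by_cases h : j = i
    · subst h
      simpa using measurable_snd
    · simp only [Function.update_of_ne h]
      exact (measurable_pi_apply j).comp measurable_fst
  refine Measure.eq_infinitePi _ fun s t ht => ?_
  rw [Measure.map_apply hmeas (MeasurableSet.pi s.countable_toSet fun j _ => ht j)]
  have key : (fun p : (∀ j, X j) × X i => Function.update p.1 i p.2) ⁻¹' (Set.pi s t)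
      = (Set.pi (↑(s.erase i) : Set ι) t) ×ˢ (if i ∈ s then t i else Set.univ) := by
    ext ⟨ω, y⟩
    simp only [Set.mem_preimage, Set.mem_pi, Finset.mem_coe, Set.mem_prod, Finset.mem_erase]
    constructor
    · intro h
      refine ⟨fun j hj => by simpa [Function.update_of_ne hj.1] using h j hj.2, ?_⟩
      split_ifs with his
      · simpa using h i his
      · trivial
    · rintro ⟨h1, h2⟩ j hj
      by_cases hji : j = i
      · subst hji
        simpa [hj] using h2
      · simpa [Function.update_of_ne hji] using h1 j ⟨hji, hj⟩
  rw [key, Measure.prod_prod, Measure.infinitePi_pi _ (fun j _ => ht j)]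
  split_ifs with his
  · rw [Finset.prod_erase_mul _ _ his]
  · rw [measure_univ, mul_one, Finset.erase_eq_of_notMem his]

/-- Integrates out one coordinate. As only an upper bound is claimed, `f` and `g` need not be
measurable. -/
theorem lintegral_infinitePi_le_of_resample {ι : Type*} [DecidableEq ι] {X : ι → Type*}
    [∀ i, MeasurableSpace (X i)] (μ : ∀ i, Measure (X i)) [∀ i, IsProbabilityMeasure (μ i)] (i : ι)
    {f g : (∀ i, X i) → ENNReal}
    (h : ∀ ω, ∫⁻ y, f (Function.update ω i y) ∂(μ i) ≤ g ω) :
    ∫⁻ ω, f ω ∂(Measure.infinitePi μ) ≤ ∫⁻ ω, g ω ∂(Measure.infinitePi μ) := by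
  conv_lhs => rw [← map_update_infinitePi μ i]
  refine (lintegral_map_le _ _).trans ((lintegral_prod_le _).trans ?_)
  exact lintegral_mono h

/-- Law of a single entry of the marks. -/
noncomputable def markLaw (r : ℝ) : Measure (ℝ × Bool) :=
  (expMeasure r).prod (PMF.uniformOfFintype Bool).toMeasure

theorem isProbabilityMeasure_markLaw {r : ℝ} (hr : 0 < r) :
    IsProbabilityMeasure (markLaw r) := by
  have := isProbabilityMeasure_expMeasure hr
  unfold markLaw
  infer_instance

theorem lintegral_marksLaw_le_of_resample {r : ℝ} (hr : 0 < r) (p : ℤ × ℕ)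
    {f g : MarkSpace → ENNReal}
    (h : ∀ ω, ∫⁻ y, f (Function.update ω p y) ∂(markLaw r) ≤ g ω) :
    ∫⁻ ω, f ω ∂(marksLaw r) ≤ ∫⁻ ω, g ω ∂(marksLaw r) := by
  have := isProbabilityMeasure_markLaw hr
  exact lintegral_infinitePi_le_of_resample (fun _ : ℤ × ℕ => markLaw r) p h

/-- Extending the density to negative arguments only enlarges the integral, and frees later
translations from a case distinction. -/
theorem lintegral_expMeasure_le {r : ℝ} (hr : 0 < r) (f : ℝ → ENNReal) (hf : Measurable f) :
    ∫⁻ x, f x ∂(expMeasure r) ≤ ∫⁻ x, ENNReal.ofReal (r * Real.exp (-(r * x))) * f x := by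
  have : expMeasure r = volume.withDensity (exponentialPDF r) := rfl
  have hm : Measurable (exponentialPDF r) := (measurable_exponentialPDFReal r).ennreal_ofReal
  rw [this, lintegral_withDensity_eq_lintegral_mul _ hm hf]
  refine lintegral_mono fun x => ?_
  simp only [Pi.mul_apply, exponentialPDF_eq]
  gcongr
  split_ifs
  · exact le_rfl
  · positivity

theorem expMeasure_Ioi_le {r : ℝ} (hr : 0 < r) (s : ℝ) :
    expMeasure r (Set.Ioi s) ≤ ENNReal.ofReal (Real.exp (-(r * s))) := by
  have := isProbabilityMeasure_expMeasure hr
  rw [← Set.compl_Iic, prob_compl_eq_one_sub measurableSet_Iic]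
  have h : expMeasure r (Set.Iic s) = ENNReal.ofReal (if 0 ≤ s then 1 - Real.exp (-(r * s)) else 0) := by
    rw [← lintegral_exponentialPDF_eq_antiDeriv hr s]
    exact withDensity_apply _ measurableSet_Iic
  rw [h, ← ENNReal.ofReal_one, ← ENNReal.ofReal_sub _ (by
    split_ifs with hs
    · have : Real.exp (-(r * s)) ≤ 1 := Real.exp_le_one_iff.2 (by nlinarith)
      linarith
    · exact le_rfl)]
  refine ENNReal.ofReal_le_ofReal ?_
  split_ifs with hs
  · linarith
  · have : 1 ≤ Real.exp (-(r * s)) := Real.one_le_exp_iff.2 (by nlinarith)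
    linarith

theorem expMeasure_Iic_zero {r : ℝ} (hr : 0 < r) : expMeasure r (Set.Iic 0) = 0 := by
  have h : expMeasure r (Set.Iic 0) = ∫⁻ y in Set.Iic 0, exponentialPDF r y :=
    withDensity_apply _ measurableSet_Iic
  rw [h, lintegral_exponentialPDF_eq_antiDeriv hr]
  simp

theorem ae_pos_waitingTime {r : ℝ} (hr : 0 < r) :
    ∀ᵐ ω ∂(marksLaw r), ∀ p : ℤ × ℕ, 0 < (ω p).1 := by
  have := isProbabilityMeasure_markLaw hr
  have := isProbabilityMeasure_expMeasure hr
  rw [ae_all_iff]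
  intro p
  have hp := measurePreserving_eval_infinitePi (fun _ : ℤ × ℕ => markLaw r) p
  have h1 : ∀ᵐ y ∂(markLaw r), 0 < y.1 := by
    have h2 : (markLaw r).map Prod.fst = expMeasure r := by
      rw [markLaw, Measure.map_fst_prod, measure_univ, one_smul]
    have h3 : ∀ᵐ y ∂((markLaw r).map Prod.fst), 0 < y := by
      rw [h2, ae_iff]
      simpa [Set.Iic] using expMeasure_Iic_zero hr
    exact ae_of_ae_map (by fun_prop) h3
  exact hp.quasiMeasurePreserving.ae h1

/-! ### Probability of a given history of marks -/

/-- Time of the `k`-th mark at the pair `{b, b + 1}` with marks counted from `1`. -/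
def arrivalTime (ω : MarkSpace) (b : ℤ) (k : ℕ) : ℝ := ∑ i ∈ Finset.range k, (ω (b, i)).1

theorem markTime_eq_arrivalTime (ω : MarkSpace) (b : ℤ) (k : ℕ) :
    markTime ω (b, k) = arrivalTime ω b (k + 1) := rfl

theorem arrivalTime_update_of_le (ω : MarkSpace) {b b' : ℤ} {i k : ℕ} (y : ℝ × Bool)
    (h : b' = b → k ≤ i) :
    arrivalTime (Function.update ω (b, i) y) b' k = arrivalTime ω b' k := by
  refine Finset.sum_congr rfl fun j hj => ?_
  rw [Function.update_of_ne]
  intro he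
  have := Finset.mem_range.1 hj
  simp only [Prod.mk.injEq] at he
  have := h he.1
  omega

theorem arrivalTime_update_succ (ω : MarkSpace) (b : ℤ) (i : ℕ) (y : ℝ × Bool) :
    arrivalTime (Function.update ω (b, i) y) b (i + 1) = arrivalTime ω b i + y.1 := by
  unfold arrivalTime
  rw [Finset.sum_range_succ, Function.update_self]
  congr 1
  exact arrivalTime_update_of_le ω y fun _ => le_rfl

/-- Number of letters of `w` that belong to the pair `{b, b + 1}`. -/
def markCount (w : List (ℤ × Bool)) (b : ℤ) : ℕ := (w.map Prod.fst).count b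

theorem markCount_cons (l : ℤ × Bool) (w : List (ℤ × Bool)) (b : ℤ) :
    markCount (l :: w) b = markCount w b + if l.1 = b then 1 else 0 := by
  simp [markCount, List.count_cons]

/-- The time of the last mark if the marks in reverse chronological order are `w`. -/
def lastTime (ω : MarkSpace) : List (ℤ × Bool) → ℝ
  | [] => 0
  | l :: w => arrivalTime ω l.1 (markCount w l.1 + 1)

/-- The first marks that occur, in reverse chronological order, are `w`. -/
def Follows (ω : MarkSpace) : List (ℤ × Bool) → Prop
  | [] => True
  | l :: w => Follows ω w ∧ lastTime ω w ≤ arrivalTime ω l.1 (markCount w l.1 + 1) ∧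
      (ω (l.1, markCount w l.1)).2 = l.2

theorem lastTime_update (ω : MarkSpace) (w : List (ℤ × Bool)) {b : ℤ} {i : ℕ}
    (h : markCount w b ≤ i) (y : ℝ × Bool) :
    lastTime (Function.update ω (b, i) y) w = lastTime ω w := by
  cases w with
  | nil => rfl
  | cons l w =>
    refine arrivalTime_update_of_le ω y fun hb => ?_
    rw [markCount_cons, if_pos hb] at h
    rw [hb]
    exact h

theorem follows_update (ω : MarkSpace) (w : List (ℤ × Bool)) {b : ℤ} {i : ℕ}
    (h : markCount w b ≤ i) (y : ℝ × Bool) :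
    Follows (Function.update ω (b, i) y) w ↔ Follows ω w := by
  induction w with
  | nil => rfl
  | cons l w ih =>
    rw [markCount_cons] at h
    have h' : markCount w b ≤ i := le_trans (Nat.le_add_right _ _) h
    have hne : (l.1, markCount w l.1) ≠ (b, i) := by
      intro he
      simp only [Prod.mk.injEq] at he
      rw [if_pos he.1, ← he.1, he.2] at h
      omega
    rw [Follows, Follows, ih h', lastTime_update ω w h' y, Function.update_of_ne hne,
      arrivalTime_update_of_le ω y]
    intro hb
    rw [if_pos hb] at h
    rw [hb]
    exact h

/-- Upper bound for the conditional probability that the next mark at `{b, b + 1}` comes after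
time `t`, given `k` marks at this pair before time `t`. -/
noncomputable def survival (r t : ℝ) (ω : MarkSpace) (b : ℤ) (k : ℕ) : ENNReal :=
  ENNReal.ofReal (Real.exp (-(r * (t - arrivalTime ω b k))))

open Classical in
/-- Expectation of a function of the last time weighted by the survival probabilities. -/
noncomputable def survivalIntegral (r t : ℝ) (B : Finset ℤ) (w : List (ℤ × Bool))
    (f : ℝ → ENNReal) : ENNReal :=
  ∫⁻ ω, (if Follows ω w then f (lastTime ω w) else 0) *
    ∏ b ∈ B, survival r t ω b (markCount w b) ∂(marksLaw r)

-- The waiting times with indices `c b`, `b ∈ s`, do not enter `h`, so they can be integrated out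
-- one by one, each yielding an exponential tail.
open Classical in
theorem lintegral_prod_late_le {r : ℝ} (hr : 0 < r) (t : ℝ) (c : ℤ → ℕ) (s : Finset ℤ) :
    ∀ h : MarkSpace → ENNReal,
      (∀ b ∈ s, ∀ ω y, h (Function.update ω (b, c b) y) = h ω) →
      ∫⁻ ω, h ω * ∏ b ∈ s, (if t < arrivalTime ω b (c b + 1) then 1 else 0) ∂(marksLaw r)
        ≤ ∫⁻ ω, h ω * ∏ b ∈ s, survival r t ω b (c b) ∂(marksLaw r) := by
  have := isProbabilityMeasure_expMeasure hr
  induction s using Finset.induction_on with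
  | empty => intro h _; simp
  | insert b s hb ih =>
    intro h hh
    have step := ih (fun ω => h ω * survival r t ω b (c b)) (fun b' hb' ω y => by
      rw [hh b' (Finset.mem_insert_of_mem hb')]
      unfold survival
      rw [arrivalTime_update_of_le]
      rintro rfl
      exact le_rfl)
    calc _ ≤ ∫⁻ ω, h ω * survival r t ω b (c b) *
          ∏ b ∈ s, (if t < arrivalTime ω b (c b + 1) then 1 else 0) ∂(marksLaw r) := by
          refine lintegral_marksLaw_le_of_resample hr (b, c b) fun ω => ?_
          simp only [Finset.prod_insert hb, arrivalTime_update_succ,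
            hh b (Finset.mem_insert_self _ _)]
          have hprod : ∀ y : ℝ × Bool,
              (∏ x ∈ s, if t < arrivalTime (Function.update ω (b, c b) y) x (c x + 1)
                then (1 : ENNReal) else 0)
              = ∏ x ∈ s, if t < arrivalTime ω x (c x + 1) then (1 : ENNReal) else 0 := by
            intro y
            refine Finset.prod_congr rfl fun x hx => ?_
            rw [arrivalTime_update_of_le]
            rintro rfl
            exact absurd hx hb
          simp only [hprod]
          set P := ∏ x ∈ s, if t < arrivalTime ω x (c x + 1) then (1 : ENNReal) else 0
          have hm : Measurable fun y : ℝ × Bool =>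
              if t < arrivalTime ω b (c b) + y.1 then (1 : ENNReal) else 0 :=
            Measurable.ite (measurableSet_lt measurable_const (by fun_prop)) measurable_const
              measurable_const
          have hint : ∫⁻ y : ℝ × Bool, (if t < arrivalTime ω b (c b) + y.1 then (1 : ENNReal) else 0)
              ∂(markLaw r) ≤ survival r t ω b (c b) := by
            have hset : (fun y : ℝ × Bool =>
                if t < arrivalTime ω b (c b) + y.1 then (1 : ENNReal) else 0)
                = Set.indicator ((Set.Ioi (t - arrivalTime ω b (c b))) ×ˢ Set.univ) 1 := by
              ext y
              simp only [Set.indicator_apply, Set.mem_prod, Set.mem_Ioi, Set.mem_univ, and_true,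
                sub_lt_iff_lt_add', Pi.one_apply]
            rw [hset, lintegral_indicator_one (measurableSet_Ioi.prod MeasurableSet.univ), markLaw,
              Measure.prod_prod, measure_univ, mul_one]
            exact expMeasure_Ioi_le hr _
          calc _ = ∫⁻ y : ℝ × Bool, (h ω * P) *
                (if t < arrivalTime ω b (c b) + y.1 then (1 : ENNReal) else 0) ∂(markLaw r) := by
                refine lintegral_congr fun y => ?_
                ring
            _ = (h ω * P) * ∫⁻ y : ℝ × Bool,
                (if t < arrivalTime ω b (c b) + y.1 then (1 : ENNReal) else 0) ∂(markLaw r) :=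
                lintegral_const_mul _ hm
            _ ≤ (h ω * P) * survival r t ω b (c b) := by gcongr
            _ = _ := by ring
      _ ≤ _ := step
      _ = _ := by
          refine lintegral_congr fun ω => ?_
          rw [Finset.prod_insert hb]
          ring

theorem lintegral_markLaw_snd_eq {r : ℝ} (hr : 0 < r) (a : Bool) (g : ℝ → ENNReal)
    (hg : Measurable g) :
    ∫⁻ y, (if y.2 = a then g y.1 else 0) ∂(markLaw r) = 2⁻¹ * ∫⁻ x, g x ∂(expMeasure r) := by
  have := isProbabilityMeasure_expMeasure hr
  have hmul : (fun y : ℝ × Bool => if y.2 = a then g y.1 else 0)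
      = fun y => g y.1 * (if y.2 = a then 1 else 0) := by
    ext y
    split_ifs <;> simp
  have hc : ∫⁻ y : Bool, (if y = a then (1 : ENNReal) else 0)
      ∂((PMF.uniformOfFintype Bool).toMeasure) = 2⁻¹ := by
    have : (fun y : Bool => if y = a then (1 : ENNReal) else 0) = Set.indicator {a} 1 := by
      ext y
      simp [Set.indicator_apply]
    rw [this, lintegral_indicator_one (measurableSet_singleton a),
      PMF.toMeasure_apply_singleton _ _ (measurableSet_singleton a)]
    simp
  rw [hmul, markLaw, lintegral_prod_mul (g := fun y : Bool => if y = a then (1 : ENNReal) else 0)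
    hg.aemeasurable (measurable_of_countable _).aemeasurable, hc, mul_comm]

/-- Integrate out the waiting time x of the latest mark. Its density r exp(-rx) times the survival
factor exp(-r(t - τ - x)) does not depend on x, so the time of this mark is left with Lebesgue
measure on the half-line after the previous mark. The attribute contributes 1/2. -/
theorem survivalIntegral_cons_le {r : ℝ} (hr : 0 < r) (t : ℝ) {B : Finset ℤ} (l : ℤ × Bool)
    (hl : l.1 ∈ B) (w : List (ℤ × Bool)) {f g : ℝ → ENNReal} (hf : Measurable f)
    (hfg : ∀ s, ∫⁻ u in Set.Ici s, f u ≤ g s) :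
    survivalIntegral r t B (l :: w) f
      ≤ ENNReal.ofReal (r / 2) * survivalIntegral r t B w g := by
  classical
  obtain ⟨b, a⟩ := l
  have hconst : ENNReal.ofReal (r / 2) ≠ ⊤ := ENNReal.ofReal_ne_top
  unfold survivalIntegral
  rw [← lintegral_const_mul' _ _ hconst]
  -- Marks are numbered from 0, so this is the entry of the new letter; neither `Follows ω w` nor
  -- `lastTime ω w` reads it.
  refine lintegral_marksLaw_le_of_resample hr (b, markCount w b) fun ω => ?_
  set k := markCount w b
  set τ := arrivalTime ω b k with hτ
  set Q := ∏ b' ∈ B.erase b, survival r t ω b' (markCount w b') with hQ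
  have hprod : ∀ y : ℝ × Bool, ∏ b' ∈ B, survival r t (Function.update ω (b, k) y) b'
      (markCount ((b, a) :: w) b')
      = ENNReal.ofReal (Real.exp (-(r * (t - (τ + y.1))))) * Q := by
    intro y
    rw [← Finset.mul_prod_erase _ _ hl]
    congr 1
    · unfold survival
      rw [markCount_cons, if_pos rfl, arrivalTime_update_succ]
    · refine Finset.prod_congr rfl fun b' hb' => ?_
      have hne := (Finset.mem_erase.1 hb').1
      unfold survival
      rw [markCount_cons, if_neg (Ne.symm hne), add_zero, arrivalTime_update_of_le]
      exact fun h => absurd h hne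
  have hprod' : ∏ b' ∈ B, survival r t ω b' (markCount w b')
      = ENNReal.ofReal (Real.exp (-(r * (t - τ)))) * Q := by
    rw [← Finset.mul_prod_erase _ _ hl]
    rfl
  have hfol : ∀ y : ℝ × Bool, Follows (Function.update ω (b, k) y) ((b, a) :: w) ↔
      Follows ω w ∧ lastTime ω w ≤ τ + y.1 ∧ y.2 = a := by
    intro y
    rw [Follows, follows_update ω w le_rfl, lastTime_update ω w le_rfl, arrivalTime_update_succ,
      Function.update_self]
  have hlast : ∀ y : ℝ × Bool, lastTime (Function.update ω (b, k) y) ((b, a) :: w) = τ + y.1 := by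
    intro y
    rw [lastTime, arrivalTime_update_succ]
  simp only [hprod, hprod', hfol, hlast]
  by_cases hF : Follows ω w
  · simp only [hF, true_and, if_true]
    set G : ℝ → ENNReal := fun x => (if lastTime ω w ≤ τ + x then f (τ + x) else 0) *
      ENNReal.ofReal (Real.exp (-(r * (t - (τ + x))))) with hG
    have hGm : Measurable G := by
      refine Measurable.mul (Measurable.ite (measurableSet_le measurable_const (by fun_prop))
        (hf.comp (by fun_prop)) measurable_const) (by fun_prop)
    calc _ = ∫⁻ y : ℝ × Bool, (if y.2 = a then G y.1 else 0) * Q ∂(markLaw r) := by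
          refine lintegral_congr fun y => ?_
          simp only [hG]
          by_cases h1 : lastTime ω w ≤ τ + y.1 <;> by_cases h2 : y.2 = a <;>
            simp [h1, h2, mul_assoc]
      _ = (∫⁻ y : ℝ × Bool, (if y.2 = a then G y.1 else 0) ∂(markLaw r)) * Q := by
          refine lintegral_mul_const _ ?_
          exact Measurable.ite (measurable_snd (measurableSet_singleton a))
            (hGm.comp measurable_fst) measurable_const
      _ = 2⁻¹ * (∫⁻ x, G x ∂(expMeasure r)) * Q := by
          rw [lintegral_markLaw_snd_eq hr a G hGm]
      _ ≤ 2⁻¹ * (∫⁻ x, ENNReal.ofReal (r * Real.exp (-(r * x))) * G x) * Q := by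
          exact mul_le_mul' (mul_le_mul' le_rfl (lintegral_expMeasure_le hr G hGm)) le_rfl
      _ = 2⁻¹ * (∫⁻ x, ENNReal.ofReal (r * Real.exp (-(r * (t - τ)))) *
            (if lastTime ω w ≤ τ + x then f (τ + x) else 0)) * Q := by
          congr 2
          refine lintegral_congr fun x => ?_
          simp only [hG]
          rw [mul_left_comm, mul_comm, mul_comm (ENNReal.ofReal _) (ENNReal.ofReal _),
            ← ENNReal.ofReal_mul (Real.exp_nonneg _)]
          congr 2
          rw [mul_left_comm, ← Real.exp_add]
          congr 2
          ring
      _ = 2⁻¹ * (ENNReal.ofReal (r * Real.exp (-(r * (t - τ)))) *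
            ∫⁻ u in Set.Ici (lastTime ω w), f u) * Q := by
          congr 2
          rw [lintegral_const_mul' _ _ ENNReal.ofReal_ne_top]
          congr 1
          rw [lintegral_add_left_eq_self (fun u => if lastTime ω w ≤ u then f u else 0) τ,
            ← lintegral_indicator measurableSet_Ici]
          rfl
      _ ≤ 2⁻¹ * (ENNReal.ofReal (r * Real.exp (-(r * (t - τ)))) * g (lastTime ω w)) * Q := by
          gcongr
          exact hfg _
      _ = _ := by
          rw [ENNReal.ofReal_mul hr.le, ENNReal.ofReal_div_of_pos two_pos, div_eq_mul_inv,
            ENNReal.ofReal_ofNat]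
          ring
  · simp [hF]

/-- The volume of the ordered `j`-tuples of times in `[s, t]`. -/
noncomputable def simplexVolume (t : ℝ) (j : ℕ) (s : ℝ) : ENNReal :=
  if s ≤ t then ENNReal.ofReal ((t - s) ^ j / j.factorial) else 0

theorem measurable_simplexVolume (t : ℝ) (j : ℕ) : Measurable (simplexVolume t j) :=
  Measurable.ite measurableSet_Iic (by fun_prop) measurable_const

theorem setLIntegral_simplexVolume_le (t : ℝ) (j : ℕ) (s : ℝ) :
    ∫⁻ u in Set.Ici s, simplexVolume t j u ≤ simplexVolume t (j + 1) s := by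
  have hind : ∀ u, (Set.Ici s).indicator (simplexVolume t j) u
      = (Set.Icc s t).indicator (fun u => ENNReal.ofReal ((t - u) ^ j / j.factorial)) u := by
    intro u
    simp only [Set.indicator_apply, simplexVolume, Set.mem_Ici, Set.mem_Icc]
    by_cases h1 : s ≤ u <;> by_cases h2 : u ≤ t <;> simp [h1, h2]
  rw [← lintegral_indicator measurableSet_Ici]
  simp only [hind]
  rw [lintegral_indicator measurableSet_Icc]
  by_cases hst : s ≤ t
  · rw [simplexVolume, if_pos hst, ← ofReal_integral_eq_lintegral_ofReal]
    · refine ENNReal.ofReal_le_ofReal (le_of_eq ?_)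
      rw [integral_Icc_eq_integral_Ioc, ← intervalIntegral.integral_of_le hst,
        intervalIntegral.integral_div,
        intervalIntegral.integral_comp_sub_left (fun x => x ^ j) t, integral_pow]
      rw [Nat.factorial_succ]
      push_cast
      have : (j.factorial : ℝ) ≠ 0 := by positivity
      have : (j : ℝ) + 1 ≠ 0 := by positivity
      field_simp
      simp
    · exact (by fun_prop : Continuous fun u : ℝ => (t - u) ^ j / j.factorial).integrableOn_Icc
    · refine (ae_restrict_iff' measurableSet_Icc).2 (Filter.Eventually.of_forall fun u hu => ?_)
      have : 0 ≤ t - u := sub_nonneg.2 hu.2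
      simp only [Pi.zero_apply]
      positivity
  · rw [Set.Icc_eq_empty hst]
    simp

/-- Each removed letter integrates one more ordered time; the induction therefore needs every `j`.
-/
theorem survivalIntegral_simplexVolume_le {r : ℝ} (hr : 0 < r) (t : ℝ) (B : Finset ℤ)
    (w : List (ℤ × Bool)) (hw : ∀ l ∈ w, l.1 ∈ B) (j : ℕ) :
    survivalIntegral r t B w (simplexVolume t j)
      ≤ ENNReal.ofReal (r / 2) ^ w.length *
        (ENNReal.ofReal (Real.exp (-(r * t))) ^ B.card * simplexVolume t (j + w.length) 0) := by
  have := isProbabilityMeasure_marksLaw hr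
  induction w generalizing j with
  | nil =>
    simp [survivalIntegral, Follows, lastTime, survival, arrivalTime, markCount, mul_comm]
  | cons l w ih =>
    refine (survivalIntegral_cons_le hr t l (hw l (by simp)) w (measurable_simplexVolume t j)
      (setLIntegral_simplexVolume_le t j)).trans ?_
    refine (mul_le_mul' le_rfl (ih (fun l hl => hw l (by simp [hl])) (j + 1))).trans (le_of_eq ?_)
    rw [List.length_cons, pow_succ', mul_assoc, add_assoc, add_comm 1]

/-- The reverse chronological list of the marks up to time `t` at the pairs in `B` is `w`. -/
def IsHistory (t : ℝ) (B : Finset ℤ) (w : List (ℤ × Bool)) (ω : MarkSpace) : Prop :=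
  Follows ω w ∧ lastTime ω w ≤ t ∧ ∀ b ∈ B, t < arrivalTime ω b (markCount w b + 1)

theorem measurable_arrivalTime (b : ℤ) (k : ℕ) : Measurable fun ω => arrivalTime ω b k :=
  Finset.measurable_sum _ fun i _ => measurable_fst.comp (measurable_pi_apply (b, i))

theorem measurable_lastTime (w : List (ℤ × Bool)) : Measurable fun ω => lastTime ω w := by
  cases w with
  | nil => exact measurable_const
  | cons l w => exact measurable_arrivalTime _ _

theorem measurableSet_follows (w : List (ℤ × Bool)) : MeasurableSet {ω | Follows ω w} := by
  induction w with
  | nil => exact MeasurableSet.univ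
  | cons l w ih =>
    refine ih.inter ((measurableSet_le (measurable_lastTime w) (measurable_arrivalTime _ _)).inter ?_)
    exact (measurable_snd.comp (measurable_pi_apply (l.1, markCount w l.1)))
      (measurableSet_singleton l.2)

theorem measurableSet_isHistory (t : ℝ) (B : Finset ℤ) (w : List (ℤ × Bool)) :
    MeasurableSet {ω | IsHistory t B w ω} := by
  refine (measurableSet_follows w).inter
    ((measurableSet_le (measurable_lastTime w) measurable_const).inter ?_)
  have h : {ω : MarkSpace | ∀ b ∈ B, t < arrivalTime ω b (markCount w b + 1)}
      = ⋂ b ∈ B, {ω | t < arrivalTime ω b (markCount w b + 1)} := by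
    ext ω
    simp
  have hm : MeasurableSet {ω : MarkSpace | ∀ b ∈ B, t < arrivalTime ω b (markCount w b + 1)} := by
    rw [h]
    exact Finset.measurableSet_biInter B fun b _ =>
      measurableSet_lt measurable_const (measurable_arrivalTime _ _)
  exact hm

theorem marksLaw_isHistory_le {r : ℝ} (hr : 0 < r) {t : ℝ} (ht : 0 ≤ t) (B : Finset ℤ)
    (w : List (ℤ × Bool)) (hw : ∀ l ∈ w, l.1 ∈ B) :
    marksLaw r {ω | IsHistory t B w ω} ≤
      ENNReal.ofReal (Real.exp (-(B.card * (r * t))) * (r * t / 2) ^ w.length / w.length.factorial) := by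
  classical
  -- `simplexVolume t 0` is the indicator of times at most `t`.
  have hset : ∀ ω, Set.indicator {ω | IsHistory t B w ω} (1 : MarkSpace → ENNReal) ω =
      (if Follows ω w then simplexVolume t 0 (lastTime ω w) else 0) *
        ∏ b ∈ B, (if t < arrivalTime ω b (markCount w b + 1) then 1 else 0) := by
    intro ω
    rw [Finset.prod_ite_zero]
    simp only [Set.indicator_apply, Set.mem_ofPred_eq, IsHistory, simplexVolume]
    by_cases h1 : Follows ω w <;> by_cases h2 : lastTime ω w ≤ t <;> simp [h1, h2]
  rw [← lintegral_indicator_one (measurableSet_isHistory t B w)]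
  simp only [hset]
  refine (lintegral_prod_late_le hr t (markCount w) B _ fun b _ ω y => ?_).trans
    ((survivalIntegral_simplexVolume_le hr t B w hw 0).trans (le_of_eq ?_))
  · rw [lastTime_update ω w le_rfl]
    simp only [follows_update ω w le_rfl]
  · rw [simplexVolume, if_pos ht, ← ENNReal.ofReal_pow (by positivity),
      ← ENNReal.ofReal_pow (by positivity), ← ENNReal.ofReal_mul (by positivity),
      ← ENNReal.ofReal_mul (by positivity), ← Real.exp_nat_mul]
    congr 1
    rw [zero_add, sub_zero, mul_neg, div_pow, div_pow, mul_pow]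
    ring

/-! ### The chronological list of the marks -/

/-- `P` runs backwards in time. Positive waiting times order the marks of one pair by index, so in a
list closed under smaller indices each index equals the number of earlier marks at its pair, which
is the bookkeeping of `Follows`. The last clause identifies the last time for the induction. -/
theorem follows_and_mem_iff_lt_markCount (ω : MarkSpace) (hω : ∀ p, 0 < (ω p).1) (P : List (ℤ × ℕ))
    (hsort : P.Pairwise fun p q => markTime ω q ≤ markTime ω p) (hnd : P.Nodup)
    (hdown : ∀ b i j, (b, i) ∈ P → j < i → (b, j) ∈ P) :
    Follows ω (P.map fun p => (p.1, (ω p).2)) ∧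
      (∀ b i, (b, i) ∈ P ↔ i < markCount (P.map fun p => (p.1, (ω p).2)) b) ∧
      ((∃ p ∈ P, lastTime ω (P.map fun p => (p.1, (ω p).2)) = markTime ω p) ∨ P = []) := by
  have hmono : ∀ b i j, i < j → markTime ω (b, i) < markTime ω (b, j) := by
    intro b i j hij
    refine Finset.sum_lt_sum_of_subset (i := j) ?_ ?_ ?_ (hω _) fun _ _ _ => (hω _).le
    · intro m hm
      simp only [Finset.mem_range] at hm ⊢
      omega
    · simp
    · simp only [Finset.mem_range]
      omega
  induction P with
  | nil => simp [Follows, markCount]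
  | cons p P ih =>
    obtain ⟨b₀, i₀⟩ := p
    rw [List.pairwise_cons] at hsort
    rw [List.nodup_cons] at hnd
    obtain ⟨ih1, ih2, ih3⟩ := ih hsort.2 hnd.2 (by
      intro b i j hi hj
      rcases List.mem_cons.1 (hdown b i j (List.mem_cons_of_mem _ hi) hj) with h | h
      · exfalso
        simp only [Prod.mk.injEq] at h
        obtain ⟨rfl, rfl⟩ := h
        exact absurd (hsort.1 _ hi) (not_le.2 (hmono _ _ _ hj))
      · exact h)
    set w := P.map fun p => (p.1, (ω p).2) with hw
    -- A smaller index would repeat a mark of `P`; a larger one would leave a gap at its pair.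
    have hi₀ : i₀ = markCount w b₀ := by
      have h1 : ¬ i₀ < markCount w b₀ := fun h => hnd.1 ((ih2 _ _).2 h)
      by_contra hne
      have h2 : markCount w b₀ < i₀ := by omega
      rcases List.mem_cons.1 (hdown b₀ i₀ _ List.mem_cons_self h2) with h | h
      · simp only [Prod.mk.injEq, true_and] at h
        omega
      · exact absurd ((ih2 _ _).1 h) (lt_irrefl _)
    have hcons : List.map (fun p => (p.1, (ω p).2)) ((b₀, i₀) :: P) = (b₀, (ω (b₀, i₀)).2) :: w := by
      simp [hw]
    rw [hcons]
    refine ⟨⟨ih1, ?_, ?_⟩, ?_, Or.inl ⟨(b₀, i₀), List.mem_cons_self, ?_⟩⟩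
    · rcases ih3 with ⟨q, hq, hlast⟩ | hnil
      · rw [hlast]
        have := hsort.1 q hq
        rwa [hi₀] at this
      · have hwn : w = [] := by simp [hw, hnil]
        rw [hwn]
        exact Finset.sum_nonneg fun _ _ => (hω _).le
    · simp [← hi₀]
    · intro b i
      rw [markCount_cons, List.mem_cons, ih2]
      by_cases hb : b₀ = b
      · subst hb
        simp only [Prod.mk.injEq, true_and, if_true]
        omega
      · simp [hb, Ne.symm hb]
    · simp [lastTime, ← hi₀, markTime_eq_arrivalTime]

/-- The pairs that intersect `Λ_N`. -/
noncomputable def bonds (N : ℕ) : Finset ℤ := Finset.Icc (-(N : ℤ) - 1) N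

theorem isHistory_chronologicalMarks {N : ℕ} {ω : MarkSpace} (hω : ∀ p, 0 < (ω p).1) {t : ℝ}
    (ht : 0 ≤ t) (hfin : (marksUpTo N ω t).Finite) :
    IsHistory t (bonds N) (chronologicalMarks N ω t).reverse ω ∧
      ∀ l ∈ chronologicalMarks N ω t, l.1 ∈ bonds N := by
  classical
  rw [chronologicalMarks, dif_pos hfin]
  set L := hfin.toFinset.toList.mergeSort fun p q => decide (markTime ω p ≤ markTime ω q) with hL
  have hmem : ∀ p, p ∈ L ↔ p ∈ marksUpTo N ω t := by
    intro p
    rw [hL, List.mem_mergeSort, Finset.mem_toList, Set.Finite.mem_toFinset]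
  have hsort : L.Pairwise fun p q => markTime ω p ≤ markTime ω q := by
    have := List.pairwise_mergeSort (le := fun p q => decide (markTime ω p ≤ markTime ω q))
      (fun a b c h1 h2 => by
        simp only [decide_eq_true_eq] at *
        exact h1.trans h2)
      (fun a b => by
        simp only [Bool.or_eq_true, decide_eq_true_eq]
        exact le_total _ _) hfin.toFinset.toList
    simpa using this
  have hnd : L.Nodup := (List.mergeSort_perm _ _).nodup_iff.2 (Finset.nodup_toList _)
  have hmono : ∀ b i j, j < i → markTime ω (b, j) ≤ markTime ω (b, i) := by
    intro b i j hij
    refine Finset.sum_le_sum_of_subset_of_nonneg ?_ fun _ _ _ => (hω _).le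
    intro m hm
    simp only [Finset.mem_range] at hm ⊢
    omega
  obtain ⟨h1, h2, h3⟩ := follows_and_mem_iff_lt_markCount ω hω L.reverse (List.pairwise_reverse.2 hsort)
    (List.nodup_reverse.2 hnd) (by
      intro b i j hi hj
      rw [List.mem_reverse, hmem] at hi ⊢
      exact ⟨hi.1, hi.2.1, (hmono b i j hj).trans hi.2.2⟩)
  rw [← List.map_reverse]
  refine ⟨⟨h1, ?_, ?_⟩, ?_⟩
  · rcases h3 with ⟨p, hp, hlast⟩ | hnil
    · rw [hlast]
      rw [List.mem_reverse, hmem] at hp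
      exact hp.2.2
    · rw [hnil]
      exact ht
  · intro b hb
    by_contra hle
    rw [not_lt] at hle
    have hb' := Finset.mem_Icc.1 hb
    have : (b, markCount (L.reverse.map fun p => (p.1, (ω p).2)) b) ∈ L.reverse := by
      rw [List.mem_reverse, hmem]
      exact ⟨hb'.1, hb'.2, hle⟩
    exact absurd ((h2 _ _).1 this) (lt_irrefl _)
  · intro l hl
    obtain ⟨p, hp, rfl⟩ := List.mem_map.1 hl
    rw [hmem] at hp
    exact Finset.mem_Icc.2 ⟨hp.1, hp.2.1⟩

/-- Each list of marks up to time `t` is at most as likely as if the number of marks was Poisson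
distributed and the marks were independent and uniformly distributed. -/
theorem marksLaw_chronologicalMarks_eq_le {r : ℝ} (hr : 0 < r) {t : ℝ} (ht : 0 ≤ t) (N : ℕ)
    (w : List (ℤ × Bool)) (hw : ∀ l ∈ w, l.1 ∈ bonds N) :
    marksLaw r {ω | (∀ p, 0 < (ω p).1) ∧ (marksUpTo N ω t).Finite ∧ chronologicalMarks N ω t = w} ≤
      ENNReal.ofReal (Real.exp (-((bonds N).card * (r * t))) *
        (r * t / 2) ^ w.length / w.length.factorial) := by
  have := marksLaw_isHistory_le hr ht (bonds N) w.reverse (by simpa using hw)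
  rw [List.length_reverse] at this
  refine (measure_mono ?_).trans this
  rintro ω ⟨hω, hfin, rfl⟩
  exact (isHistory_chronologicalMarks hω ht hfin).1

/-! ### Sums over lists of marks and a Markov inequality -/

/-- The possible marks. -/
noncomputable def letters (N : ℕ) : Finset (ℤ × Bool) := bonds N ×ˢ Finset.univ

/-- The lists of `m` marks. -/
noncomputable def words (N : ℕ) : ℕ → Finset (List (ℤ × Bool))
  | 0 => {[]}
  | m + 1 => (letters N ×ˢ words N m).image fun p => p.1 :: p.2

theorem mem_words {N m : ℕ} {w : List (ℤ × Bool)} :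
    w ∈ words N m ↔ w.length = m ∧ ∀ l ∈ w, l.1 ∈ bonds N := by
  induction m generalizing w with
  | zero =>
    simp only [words, Finset.mem_singleton, List.length_eq_zero_iff]
    constructor
    · rintro rfl
      simp
    · exact fun h => h.1
  | succ m ih =>
    simp only [words, Finset.mem_image, Finset.mem_product, ih, letters,
      Finset.mem_univ, and_true]
    constructor
    · rintro ⟨⟨l, v⟩, ⟨h1, h2, h3⟩, rfl⟩
      simpa [h1, h2] using h3
    · rintro ⟨h1, h2⟩
      cases w with
      | nil => simp at h1
      | cons l v =>
        exact ⟨⟨l, v⟩, ⟨h2 l (by simp), by simpa using h1, fun l hl => h2 l (by simp [hl])⟩, rfl⟩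

theorem sum_words_succ (N m : ℕ) (F : List (ℤ × Bool) → ℝ) :
    ∑ w ∈ words N (m + 1), F w = ∑ l ∈ letters N, ∑ w ∈ words N m, F (l :: w) := by
  rw [words, Finset.sum_image, Finset.sum_product]
  rintro ⟨l, v⟩ _ ⟨l', v'⟩ _ h
  simpa using h

/-- The invariant `I` restricts the one-step estimate to states that the chain can reach. -/
theorem sum_words_foldl_le {S : Type*} (N : ℕ) (step : S → ℤ × Bool → S) (I : S → Prop)
    (hI : ∀ s l, I s → I (step s l)) (F : S → ℝ) {K : ℝ} (hK : 0 ≤ K)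
    (hF : ∀ s, I s → ∑ l ∈ letters N, F (step s l) ≤ K * F s) (m : ℕ) :
    ∀ s, I s → ∑ w ∈ words N m, F (w.foldl step s) ≤ K ^ m * F s := by
  induction m with
  | zero => intro s _; simp [words]
  | succ m ih =>
    intro s hs
    rw [sum_words_succ]
    calc _ ≤ ∑ l ∈ letters N, K ^ m * F (step s l) :=
          Finset.sum_le_sum fun l _ => ih _ (hI s l hs)
      _ = K ^ m * ∑ l ∈ letters N, F (step s l) := by rw [Finset.mul_sum]
      _ ≤ K ^ m * (K * F s) := by
          gcongr
          exact hF s hs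
      _ = _ := by ring

/-- Markov inequality for a function of a chain driven by the marks whose one-step averages
grow at most by a constant factor. -/
theorem marksLaw_le_foldl_le {S : Type*} {r : ℝ} (hr : 0 < r) {t : ℝ} (ht : 0 ≤ t) (N : ℕ)
    (step : S → ℤ × Bool → S) (I : S → Prop) (hI : ∀ s l, I s → I (step s l)) (F : S → ℝ)
    (hF0 : ∀ s, 0 ≤ F s) {κ : ℝ} (hκ : 0 ≤ κ)
    (hF : ∀ s, I s → ∑ l ∈ letters N, F (step s l) ≤ (2 * (bonds N).card + 2 * κ) * F s)
    {s₀ : S} (hs₀ : I s₀) {θ : ℝ} (hθ : 0 < θ) :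
    marksLaw r {ω | (∀ p, 0 < (ω p).1) ∧ (marksUpTo N ω t).Finite ∧
        θ ≤ F ((chronologicalMarks N ω t).foldl step s₀)}
      ≤ ENNReal.ofReal (Real.exp (κ * (r * t)) * F s₀ / θ) := by
  classical
  set M := r * t with hM
  have hM0 : 0 ≤ M := by positivity
  set β : ℝ := ((bonds N).card : ℝ) with hβ
  set q : ℕ → ℝ := fun m => Real.exp (-(β * M)) * (M / 2) ^ m / m.factorial with hq
  have hq0 : ∀ m, 0 ≤ q m := fun m => by positivity
  set K : ℝ := 2 * β + 2 * κ with hKdef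
  have hK : 0 ≤ K := by positivity
  -- The exponential series gives exp(-βM + MK/2) = exp(κM); the shape of `K` is chosen for this
  -- cancellation.
  have hsum : HasSum (fun m : ℕ => q m * (K ^ m * F s₀ / θ))
      (Real.exp (κ * M) * F s₀ / θ) := by
    have h1 : HasSum (fun m : ℕ => (M / 2 * K) ^ m / m.factorial) (Real.exp (M / 2 * K)) := by
      rw [Real.exp_eq_exp_ℝ]
      exact NormedSpace.expSeries_div_hasSum_exp _
    have h2 := (h1.mul_left (Real.exp (-(β * M)))).mul_right (F s₀ / θ)
    have h3 : Real.exp (-(β * M)) * Real.exp (M / 2 * K) * (F s₀ / θ)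
        = Real.exp (κ * M) * F s₀ / θ := by
      have he : -(β * M) + M / 2 * K = κ * M := by
        rw [hKdef]
        ring
      rw [← Real.exp_add, he, mul_div_assoc]
    rw [h3] at h2
    refine h2.congr_fun fun m => ?_
    simp only [hq, mul_pow]
    ring
  have hlen : ∀ m, marksLaw r {ω | (∀ p, 0 < (ω p).1) ∧ (marksUpTo N ω t).Finite ∧
      θ ≤ F ((chronologicalMarks N ω t).foldl step s₀) ∧ (chronologicalMarks N ω t).length = m}
      ≤ ENNReal.ofReal (q m * (K ^ m * F s₀ / θ)) := by
    intro m
    calc _ ≤ marksLaw r (⋃ w ∈ (words N m).filter fun w => θ ≤ F (w.foldl step s₀),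
          {ω | (∀ p, 0 < (ω p).1) ∧ (marksUpTo N ω t).Finite ∧ chronologicalMarks N ω t = w}) := by
          refine measure_mono ?_
          rintro ω ⟨h1, h2, h3, h4⟩
          refine Set.mem_biUnion (x := chronologicalMarks N ω t) ?_ ⟨h1, h2, rfl⟩
          simp only [Finset.coe_filter, Set.mem_ofPred_eq, mem_words]
          exact ⟨⟨h4, (isHistory_chronologicalMarks h1 ht h2).2⟩, h3⟩
      _ ≤ ∑ w ∈ (words N m).filter fun w => θ ≤ F (w.foldl step s₀),
          marksLaw r {ω | (∀ p, 0 < (ω p).1) ∧ (marksUpTo N ω t).Finite ∧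
            chronologicalMarks N ω t = w} := measure_biUnion_finset_le _ _
      _ ≤ ∑ w ∈ (words N m).filter fun w => θ ≤ F (w.foldl step s₀),
          ENNReal.ofReal (q m * (F (w.foldl step s₀) / θ)) := by
          refine Finset.sum_le_sum fun w hw => ?_
          obtain ⟨hw1, hw2⟩ := Finset.mem_filter.1 hw
          obtain ⟨hw3, hw4⟩ := mem_words.1 hw1
          refine (marksLaw_chronologicalMarks_eq_le hr ht N w hw4).trans
            (ENNReal.ofReal_le_ofReal ?_)
          rw [hw3]
          -- Markov's step: `F / θ` is at least 1 on the selected words.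
          exact le_mul_of_one_le_right (hq0 m) ((one_le_div hθ).2 hw2)
      _ = ENNReal.ofReal (∑ w ∈ (words N m).filter fun w => θ ≤ F (w.foldl step s₀),
          q m * (F (w.foldl step s₀) / θ)) :=
          (ENNReal.ofReal_sum_of_nonneg fun w _ =>
            mul_nonneg (hq0 m) (div_nonneg (hF0 _) hθ.le)).symm
      _ ≤ ENNReal.ofReal (q m * (K ^ m * F s₀ / θ)) := by
          refine ENNReal.ofReal_le_ofReal ?_
          rw [← Finset.mul_sum, ← Finset.sum_div]
          refine mul_le_mul_of_nonneg_left ?_ (hq0 m)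
          gcongr
          exact (Finset.sum_le_sum_of_subset_of_nonneg (Finset.filter_subset _ _)
            fun w _ _ => hF0 _).trans (sum_words_foldl_le N step I hI F hK hF m s₀ hs₀)
  calc _ ≤ marksLaw r (⋃ m, {ω | (∀ p, 0 < (ω p).1) ∧ (marksUpTo N ω t).Finite ∧
        θ ≤ F ((chronologicalMarks N ω t).foldl step s₀) ∧
          (chronologicalMarks N ω t).length = m}) := by
        refine measure_mono ?_
        rintro ω ⟨h1, h2, h3⟩
        exact Set.mem_iUnion.2 ⟨_, h1, h2, h3, rfl⟩
    _ ≤ ∑' m, ENNReal.ofReal (q m * (K ^ m * F s₀ / θ)) :=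
        (measure_iUnion_le _).trans (ENNReal.tsum_le_tsum hlen)
    _ = _ := by
        rw [← ENNReal.ofReal_tsum_of_nonneg (fun m => mul_nonneg (hq0 m)
          (div_nonneg (mul_nonneg (pow_nonneg hK m) (hF0 _)) hθ.le)) hsum.summable, hsum.tsum_eq]

/-! ### Drift of one and of two stirring particles -/

/-- Effect of an active mark at `{b, b + 1}` on a stirring particle at `p`. -/
def exchange (N : ℕ) (b p : ℤ) : ℤ :=
  if -(N : ℤ) ≤ b ∧ b + 1 ≤ N then Equiv.swap b (b + 1) p else p

theorem stirringStep_true (N : ℕ) {n : ℕ} (b : ℤ) (x : Fin n → ℤ) :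
    stirringStep N b true x = fun i => exchange N b (x i) := by
  ext i
  simp only [stirringStep, exchange, true_and]
  split_ifs <;> rfl

theorem stirringStep_false (N : ℕ) {n : ℕ} (b : ℤ) (x : Fin n → ℤ) :
    stirringStep N b false x = x := by
  simp [stirringStep]

/-- The site `p` belongs to `Λ_N`. -/
def InBox (N : ℕ) (p : ℤ) : Prop := -(N : ℤ) ≤ p ∧ p ≤ N

theorem InBox.exchange {N : ℕ} {p : ℤ} (hp : InBox N p) (b : ℤ) : InBox N (exchange N b p) := by
  unfold InBox _root_.exchange at *
  rw [Equiv.swap_apply_def]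
  split_ifs <;> omega

theorem exchange_injective (N : ℕ) (b : ℤ) : Function.Injective (exchange N b) := by
  unfold exchange
  split_ifs
  · exact (Equiv.swap b (b + 1)).injective
  · exact Function.injective_id

theorem exchange_eq {N : ℕ} {p : ℤ} (hp : InBox N p) (b : ℤ) :
    exchange N b p = p + (if b = p then if p < N then 1 else 0 else 0)
      - (if b = p - 1 then if -(N : ℤ) < p then 1 else 0 else 0) := by
  unfold InBox exchange at *
  rw [Equiv.swap_apply_def]
  split_ifs <;> omega

theorem mem_bonds_of_inBox {N : ℕ} {p : ℤ} (hp : InBox N p) : p ∈ bonds N ∧ p - 1 ∈ bonds N := by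
  unfold InBox at hp
  simp only [bonds, Finset.mem_Icc]
  omega

/-- A particle reacts only to the two pairs containing its site. `bonds` also contains the pairs
sticking out of the box, so this holds at the walls too. -/
theorem sum_bonds_ite {R : Type*} [AddCommMonoid R] {N : ℕ} {p : ℤ} (hp : InBox N p) (u v : R) :
    ∑ b ∈ bonds N, ((if b = p then u else 0) + (if b = p - 1 then v else 0)) = u + v := by
  rw [Finset.sum_add_distrib, Finset.sum_ite_eq', Finset.sum_ite_eq',
    if_pos (mem_bonds_of_inBox hp).1, if_pos (mem_bonds_of_inBox hp).2]

theorem sum_abs_exchange_sub_le {N : ℕ} {p : ℤ} (hp : InBox N p) :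
    ∑ b ∈ bonds N, |exchange N b p - p| ≤ 2 := by
  calc _ ≤ ∑ b ∈ bonds N, ((if b = p then (1 : ℤ) else 0) + (if b = p - 1 then 1 else 0)) := by
        refine Finset.sum_le_sum fun b _ => ?_
        rw [exchange_eq hp]
        split_ifs <;> simp
    _ = 2 := by rw [sum_bonds_ite hp]; rfl

theorem abs_exchange_sub_le_one {N : ℕ} {p : ℤ} (hp : InBox N p) (b : ℤ) :
    |exchange N b p - p| ≤ 1 := by
  rw [exchange_eq hp, abs_le]
  split_ifs <;> omega

/-- In the bulk the two moves contribute 2; at a wall only the inward move is left, and it lowers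
the square by 2N - 1. -/
theorem sum_exchange_sq_sub_le {N : ℕ} {p : ℤ} (hp : InBox N p) :
    ∑ b ∈ bonds N, (exchange N b p ^ 2 - p ^ 2)
      ≤ 2 - (if p = -N ∨ p = N then 2 * (N : ℤ) else 0) := by
  have h : ∀ b ∈ bonds N, exchange N b p ^ 2 - p ^ 2 = (if b = p then
      if p < N then 2 * p + 1 else 0 else 0) + (if b = p - 1 then
      if -(N : ℤ) < p then 1 - 2 * p else 0 else 0) := by
    intro b _
    rw [exchange_eq hp]
    split_ifs <;> first | omega | ring
  rw [Finset.sum_congr rfl h, sum_bonds_ite hp]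
  unfold InBox at hp
  split_ifs <;> omega

/-- Away from the walls and from each other, the moves that separate the particles cancel those that
bring them together. Exchanging neighbours preserves their distance, so at distance one only the two
separating moves count. A wall can remove one separating move. -/
theorem le_sum_abs_exchange_sub {N : ℕ} {p q : ℤ} (hp : InBox N p) (hq : InBox N q) (hpq : p < q) :
    (if q = p + 1 then 2 else 0) - (if p = -N ∨ p = N then 1 else 0)
      - (if q = -N ∨ q = N then 1 else 0)
      ≤ ∑ b ∈ bonds N, (|exchange N b p - exchange N b q| - |p - q|) := by
  have h : ∀ b ∈ bonds N, |exchange N b p - exchange N b q| - |p - q|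
      = ((if b = p then if q = p + 1 then 0 else -1 else 0)
          + (if b = p - 1 then if -(N : ℤ) < p then 1 else 0 else 0))
        + ((if b = q then if q < N then 1 else 0 else 0)
          + (if b = q - 1 then if q = p + 1 then 0 else -1 else 0)) := by
    intro b _
    rw [abs_of_neg (by omega : p - q < 0)]
    by_cases hbp : b = p ∧ q = p + 1
    · have h1 : exchange N b p = q := by
        unfold InBox exchange at *
        rw [if_pos (by omega), Equiv.swap_apply_def]
        split_ifs <;> omega
      have h2 : exchange N b q = p := by
        unfold InBox exchange at *
        rw [if_pos (by omega), Equiv.swap_apply_def]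
        split_ifs <;> omega
      rw [h1, h2, abs_of_pos (by omega : 0 < q - p)]
      split_ifs <;> omega
    · have hle : exchange N b p - exchange N b q ≤ 0 := by
        rw [exchange_eq hp, exchange_eq hq]
        split_ifs <;> omega
      rw [abs_of_nonpos hle, exchange_eq hp, exchange_eq hq]
      unfold InBox at hp hq
      split_ifs <;> omega
  rw [Finset.sum_congr rfl h, Finset.sum_add_distrib, sum_bonds_ite hp, sum_bonds_ite hq]
  unfold InBox at hp hq
  split_ifs <;> omega

theorem le_sum_abs_exchange_sub' {N : ℕ} {p q : ℤ} (hp : InBox N p) (hq : InBox N q) :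
    (if q = p + 1 then 2 else 0) - (if p = -N ∨ p = N then 1 else 0)
      - (if q = -N ∨ q = N then 1 else 0)
      ≤ ∑ b ∈ bonds N, (|exchange N b p - exchange N b q| - |p - q|) := by
  rcases lt_trichotomy p q with h | h | h
  · exact le_sum_abs_exchange_sub hp hq h
  · subst h
    simp only [sub_self, abs_zero, Finset.sum_const_zero]
    split_ifs <;> omega
  · have := le_sum_abs_exchange_sub hq hp h
    simp only [abs_sub_comm (exchange N _ q), abs_sub_comm q p] at this
    refine le_trans ?_ this
    split_ifs <;> omega

/-- Potential of a pair of particles, whose drift dominates their local time at distance one. -/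
noncomputable def pairPotential (N : ℕ) (p q : ℤ) : ℝ :=
  |(p : ℝ) - q| - ((p : ℝ) ^ 2 + (q : ℝ) ^ 2) / N

/-- A particle at a wall costs the distance at most 1, while its quadratic term gains 2 there. In
exchange, the quadratic terms cost 2/N per particle everywhere. -/
theorem le_sum_pairPotential_exchange_sub {N : ℕ} (hN : 0 < N) {p q : ℤ} (hp : InBox N p)
    (hq : InBox N q) :
    2 * (if q = p + 1 then (1 : ℝ) else 0) - 4 / N
      ≤ ∑ b ∈ bonds N, (pairPotential N (exchange N b p) (exchange N b q) - pairPotential N p q) := by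
  have hN' : (0 : ℝ) < N := by exact_mod_cast hN
  have h1 := (Int.cast_le (R := ℝ)).2 (le_sum_abs_exchange_sub' hp hq)
  have h2 := (Int.cast_le (R := ℝ)).2 (sum_exchange_sq_sub_le hp)
  have h3 := (Int.cast_le (R := ℝ)).2 (sum_exchange_sq_sub_le hq)
  push_cast at h1 h2 h3
  have hsum : ∑ b ∈ bonds N, (pairPotential N (exchange N b p) (exchange N b q)
      - pairPotential N p q)
      = ∑ b ∈ bonds N, (|(exchange N b p : ℝ) - exchange N b q| - |(p : ℝ) - q|)
        - (∑ b ∈ bonds N, ((exchange N b p : ℝ) ^ 2 - (p : ℝ) ^ 2)) / N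
        - (∑ b ∈ bonds N, ((exchange N b q : ℝ) ^ 2 - (q : ℝ) ^ 2)) / N := by
    rw [Finset.sum_div, Finset.sum_div, ← Finset.sum_sub_distrib, ← Finset.sum_sub_distrib]
    refine Finset.sum_congr rfl fun b _ => ?_
    unfold pairPotential
    ring
  rw [hsum]
  have h2' := div_le_div_of_nonneg_right h2 hN'.le
  have h3' := div_le_div_of_nonneg_right h3 hN'.le
  have e : ∀ c : Prop, [Decidable c] → (2 - (if c then 2 * (N : ℝ) else 0)) / N
      = 2 / N - 2 * (if c then 1 else 0) := by
    intro c _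
    split_ifs
    · field_simp
    · simp
  rw [e] at h2' h3'
  have e4 : (4 : ℝ) / N = 2 / N + 2 / N := by ring
  have n1 : (0 : ℝ) ≤ if p = -(N : ℤ) ∨ p = N then 1 else 0 := by split_ifs <;> norm_num
  have n2 : (0 : ℝ) ≤ if q = -(N : ℤ) ∨ q = N then 1 else 0 := by split_ifs <;> norm_num
  have e2 : (if q = p + 1 then (2 : ℝ) else 0) = 2 * if q = p + 1 then (1 : ℝ) else 0 := by
    split_ifs <;> norm_num
  rw [e2] at h1
  linarith

theorem abs_sq_sub_sq_div_le {N : ℕ} (hN : 0 < N) {p p' : ℤ} (hp : InBox N p) (hp' : InBox N p') :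
    |((p' : ℝ) ^ 2 - (p : ℝ) ^ 2) / N| ≤ 2 * |(p' : ℝ) - p| := by
  have hN' : (0 : ℝ) < N := by exact_mod_cast hN
  have a1 : |(p : ℝ)| ≤ N := by
    rw [abs_le]; exact ⟨by exact_mod_cast hp.1, by exact_mod_cast hp.2⟩
  have a2 : |(p' : ℝ)| ≤ N := by
    rw [abs_le]; exact ⟨by exact_mod_cast hp'.1, by exact_mod_cast hp'.2⟩
  rw [abs_div, abs_of_pos hN', div_le_iff₀ hN', sq_sub_sq, abs_mul]
  have : |(p' : ℝ) + p| ≤ 2 * N := (abs_add_le _ _).trans (by linarith)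
  nlinarith [abs_nonneg ((p' : ℝ) - p)]

theorem abs_pairPotential_sub_le {N : ℕ} (hN : 0 < N) {p q p' q' : ℤ} (hp : InBox N p)
    (hq : InBox N q) (hp' : InBox N p') (hq' : InBox N q') :
    |pairPotential N p' q' - pairPotential N p q| ≤ 3 * |(p' : ℝ) - p| + 3 * |(q' : ℝ) - q| := by
  have h1 := abs_sq_sub_sq_div_le hN hp hp'
  have h2 := abs_sq_sub_sq_div_le hN hq hq'
  have h3 : |(|(p' : ℝ) - q'| - |(p : ℝ) - q|)| ≤ |(p' : ℝ) - p| + |(q' : ℝ) - q| := by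
    refine (abs_abs_sub_abs_le_abs_sub _ _).trans ?_
    have : (p' : ℝ) - q' - (p - q) = (p' - p) - (q' - q) := by ring
    rw [this]
    exact abs_sub _ _
  have e : pairPotential N p' q' - pairPotential N p q = (|(p' : ℝ) - q'| - |(p : ℝ) - q|)
      - ((p' : ℝ) ^ 2 - (p : ℝ) ^ 2) / N - ((q' : ℝ) ^ 2 - (q : ℝ) ^ 2) / N := by
    unfold pairPotential
    ring
  rw [e]
  refine (abs_sub _ _).trans ?_
  have := abs_sub (|(p' : ℝ) - q'| - |(p : ℝ) - q|) (((p' : ℝ) ^ 2 - (p : ℝ) ^ 2) / N)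
  linarith

/-! ### The potential of a configuration -/

/-- Sum of the potentials of all pairs of particles. -/
noncomputable def potential (N : ℕ) {n : ℕ} (x : Fin n → ℤ) : ℝ :=
  ∑ i, ∑ j, pairPotential N (x i) (x j)

theorem potential_comp_perm (N : ℕ) {n : ℕ} (x : Fin n → ℤ) (e : Equiv.Perm (Fin n)) :
    potential N (fun i => x (e i)) = potential N x := by
  unfold potential
  rw [← Equiv.sum_comp e (fun i => ∑ j, pairPotential N (x i) (x j))]
  exact Finset.sum_congr rfl fun i _ =>
    Equiv.sum_comp e fun j => pairPotential N (x (e i)) (x j)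

theorem abs_potential_sub_le {N : ℕ} (hN : 0 < N) {n : ℕ} {x y : Fin n → ℤ}
    (hx : ∀ i, InBox N (x i)) (hy : ∀ i, InBox N (y i)) :
    |potential N y - potential N x| ≤ 6 * n * ∑ i, |(y i : ℝ) - x i| := by
  unfold potential
  rw [← Finset.sum_sub_distrib]
  simp only [← Finset.sum_sub_distrib]
  calc _ ≤ ∑ i, ∑ j, |pairPotential N (y i) (y j) - pairPotential N (x i) (x j)| :=
        (Finset.abs_sum_le_sum_abs _ _).trans
          (Finset.sum_le_sum fun i _ => Finset.abs_sum_le_sum_abs _ _)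
    _ ≤ ∑ i, ∑ j, (3 * |(y i : ℝ) - x i| + 3 * |(y j : ℝ) - x j|) :=
        Finset.sum_le_sum fun i _ => Finset.sum_le_sum fun j _ =>
          abs_pairPotential_sub_le hN (hx i) (hx j) (hy i) (hy j)
    _ = _ := by
        simp only [Finset.sum_add_distrib, Finset.sum_const, Finset.card_univ, Fintype.card_fin,
          nsmul_eq_mul, ← Finset.mul_sum]
        ring

/-- Number of pairs of neighbouring particles. -/
noncomputable def adjacentPairs {n : ℕ} (x : Fin n → ℤ) : ℝ :=
  ∑ i, ∑ j, if x j = x i + 1 then 1 else 0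

theorem le_sum_potential_exchange_sub {N : ℕ} (hN : 0 < N) {n : ℕ} {x : Fin n → ℤ}
    (hx : ∀ i, InBox N (x i)) :
    2 * adjacentPairs x - 4 * (n : ℝ) ^ 2 / N
      ≤ ∑ b ∈ bonds N, (potential N (fun i => exchange N b (x i)) - potential N x) := by
  calc 2 * adjacentPairs x - 4 * (n : ℝ) ^ 2 / N
      = ∑ i, ∑ j, (2 * (if x j = x i + 1 then (1 : ℝ) else 0) - 4 / N) := by
        simp only [adjacentPairs, Finset.sum_sub_distrib, Finset.sum_const, Finset.card_univ,
          Fintype.card_fin, nsmul_eq_mul, ← Finset.mul_sum]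
        ring
    _ ≤ ∑ i, ∑ j, ∑ b ∈ bonds N, (pairPotential N (exchange N b (x i)) (exchange N b (x j))
          - pairPotential N (x i) (x j)) :=
        Finset.sum_le_sum fun i _ => Finset.sum_le_sum fun j _ =>
          le_sum_pairPotential_exchange_sub hN (hx i) (hx j)
    _ = _ := by
        simp only [potential, ← Finset.sum_sub_distrib]
        rw [Finset.sum_comm (s := bonds N)]
        exact Finset.sum_congr rfl fun i _ => Finset.sum_comm

theorem abs_potential_exchange_sub_le {N : ℕ} (hN : 0 < N) {n : ℕ} {x : Fin n → ℤ}
    (hx : ∀ i, InBox N (x i)) (b : ℤ) :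
    |potential N (fun i => exchange N b (x i)) - potential N x| ≤ 6 * (n : ℝ) ^ 2 := by
  refine (abs_potential_sub_le hN hx fun i => (hx i).exchange b).trans ?_
  have : ∑ i, |(exchange N b (x i) : ℝ) - x i| ≤ n := by
    refine (Finset.sum_le_sum (g := fun _ => (1 : ℝ)) fun i _ => ?_).trans (by simp)
    exact_mod_cast abs_exchange_sub_le_one (hx i) b
  nlinarith [(Nat.cast_nonneg n : (0 : ℝ) ≤ n)]

/-- One factor of the square is bounded uniformly, the other is summed over the pairs. Each particle
reacts to at most two pairs, so the bound does not involve `N`. -/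
theorem sum_potential_exchange_sub_sq_le {N : ℕ} (hN : 0 < N) {n : ℕ} {x : Fin n → ℤ}
    (hx : ∀ i, InBox N (x i)) :
    ∑ b ∈ bonds N, (potential N (fun i => exchange N b (x i)) - potential N x) ^ 2
      ≤ 72 * (n : ℝ) ^ 4 := by
  have hn : (0 : ℝ) ≤ n := Nat.cast_nonneg n
  calc _ ≤ ∑ b ∈ bonds N, 6 * (n : ℝ) ^ 2 * (6 * n * ∑ i, |(exchange N b (x i) : ℝ) - x i|) := by
        refine Finset.sum_le_sum fun b _ => ?_
        rw [← sq_abs, sq]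
        exact mul_le_mul (abs_potential_exchange_sub_le hN hx b)
          (abs_potential_sub_le hN hx fun i => (hx i).exchange b) (abs_nonneg _) (by positivity)
    _ = 36 * (n : ℝ) ^ 3 * ∑ i, ∑ b ∈ bonds N, |(exchange N b (x i) : ℝ) - x i| := by
        rw [Finset.sum_comm, Finset.mul_sum]
        refine Finset.sum_congr rfl fun b _ => ?_
        ring
    _ ≤ 36 * (n : ℝ) ^ 3 * ∑ _i : Fin n, (2 : ℝ) := by
        gcongr with i
        exact_mod_cast sum_abs_exchange_sub_le (hx i)
    _ = _ := by
        simp only [Finset.sum_const, Finset.card_univ, Fintype.card_fin, nsmul_eq_mul]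
        ring

/-! ### One coupled step and the discrepancy -/

/-- Admissible states of the coupled process. -/
structure Admissible (N : ℕ) {n : ℕ} (c : (Fin n → ℤ) × (Fin n → ℤ)) : Prop where
  injective : Function.Injective c.1
  stirring_inBox : ∀ i, InBox N (c.1 i)
  independent_inBox : ∀ i, InBox N (c.2 i)

theorem Admissible.couplingStep {N n : ℕ} {σ : Equiv.Perm (Fin n)}
    {c : (Fin n → ℤ) × (Fin n → ℤ)} (hc : Admissible N c) (l : ℤ × Bool) :
    Admissible N (couplingStep N σ c l) := by
  obtain ⟨b, a⟩ := l
  refine ⟨?_, ?_, ?_⟩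
  · cases a
    · simpa [_root_.couplingStep, stirringStep_false] using hc.injective
    · simp only [_root_.couplingStep, stirringStep_true]
      exact (exchange_injective N b).comp hc.injective
  · cases a
    · simpa [_root_.couplingStep, stirringStep_false] using hc.stirring_inBox
    · simp only [_root_.couplingStep, stirringStep_true]
      exact fun i => (hc.stirring_inBox i).exchange b
  · intro i
    simp only [_root_.couplingStep, independentStep]
    split_ifs with h
    · exact h i
    · exact hc.independent_inBox i

/-- At most one independent particle attempts a jump at each mark. -/
theorem attemptedJump_eq_zero {n : ℕ} {σ : Equiv.Perm (Fin n)} {b : ℤ} {a : Bool}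
    {x : Fin n → ℤ} (hx : Function.Injective x) {i j : Fin n} (hij : i ≠ j)
    (h : attemptedJump σ b a x i ≠ 0) : attemptedJump σ b a x j = 0 := by
  have hne : x i ≠ x j := fun h => hij (hx h)
  have hσ : σ i < σ j ∨ σ j < σ i := lt_or_gt_of_ne fun h => hij (σ.injective h)
  by_cases hi : x i = b
  · by_cases hj : x j = b + 1
    · have hi' : (∃ m, x m = b + 1 ∧ σ m < σ i) ↔ σ j < σ i :=
        ⟨fun ⟨m, hm, hlt⟩ => hx (hm.trans hj.symm) ▸ hlt, fun h => ⟨j, hj, h⟩⟩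
      have hj' : (∃ m, x m = b ∧ σ m < σ j) ↔ σ i < σ j :=
        ⟨fun ⟨m, hm, hlt⟩ => hx (hm.trans hi.symm) ▸ hlt, fun h => ⟨i, hi, h⟩⟩
      have hjb : ¬ x j = b := by omega
      simp only [attemptedJump, hi', hj', if_pos hi, if_pos hj, if_neg hjb] at h ⊢
      -- Exactly one of two neighbours sees priority across the pair, so one jumps on passive marks
      -- and the other on active ones.
      rcases hσ with hlt | hlt
      · have := hlt.asymm
        cases a <;> simp [hlt, this] at h ⊢
      · have := hlt.asymm
        cases a <;> simp [hlt, this] at h ⊢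
    · have hjb : ¬ x j = b := by omega
      simp [attemptedJump, hj, hjb]
  · by_cases hi1 : x i = b + 1
    · by_cases hj : x j = b
      · have hi' : (∃ m, x m = b ∧ σ m < σ i) ↔ σ j < σ i :=
          ⟨fun ⟨m, hm, hlt⟩ => hx (hm.trans hj.symm) ▸ hlt, fun h => ⟨j, hj, h⟩⟩
        have hj' : (∃ m, x m = b + 1 ∧ σ m < σ j) ↔ σ i < σ j :=
          ⟨fun ⟨m, hm, hlt⟩ => hx (hm.trans hi1.symm) ▸ hlt, fun h => ⟨i, hi1, h⟩⟩
        simp only [attemptedJump, hi', hj', if_pos hi1, if_pos hj, if_neg hi] at h ⊢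
        rcases hσ with hlt | hlt
        · have := hlt.asymm
          cases a <;> simp [hlt, this] at h ⊢
        · have := hlt.asymm
          cases a <;> simp [hlt, this] at h ⊢
      · have hjb : ¬ x j = b + 1 := by omega
        simp [attemptedJump, hj, hjb]
    · exact absurd (by simp [attemptedJump, hi, hi1]) h

/-- `independentStep` accepts or rejects all jumps jointly. As at most one particle attempts a jump,
this is the same as suppressing each particle separately. -/
theorem independentStep_apply {N n : ℕ} {σ : Equiv.Perm (Fin n)} {b : ℤ} {a : Bool}
    {x z : Fin n → ℤ} (hx : Function.Injective x) (hz : ∀ i, InBox N (z i)) (ℓ : Fin n) :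
    independentStep N σ b a x z ℓ =
      if -(N : ℤ) ≤ z ℓ + attemptedJump σ b a x ℓ ∧ z ℓ + attemptedJump σ b a x ℓ ≤ N then
        z ℓ + attemptedJump σ b a x ℓ else z ℓ := by
  unfold independentStep
  dsimp only
  by_cases h0 : attemptedJump σ b a x ℓ = 0
  · split_ifs <;> simp [h0]
  · have hiff : (∀ i, -(N : ℤ) ≤ z i + attemptedJump σ b a x i ∧
        z i + attemptedJump σ b a x i ≤ N) ↔
        (-(N : ℤ) ≤ z ℓ + attemptedJump σ b a x ℓ ∧ z ℓ + attemptedJump σ b a x ℓ ≤ N) := by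
      refine ⟨fun h => h ℓ, fun h i => ?_⟩
      by_cases hi : i = ℓ
      · subst hi
        exact h
      · rw [attemptedJump_eq_zero hx (Ne.symm hi) h0, add_zero]
        exact hz i
    simp only [hiff]
    split_ifs <;> rfl

/-- A mark at `{b, b + 1}` finds the stirring particle `ℓ` next to one having priority over it. -/
def Collides {n : ℕ} (σ : Equiv.Perm (Fin n)) (x : Fin n → ℤ) (ℓ : Fin n) (b : ℤ) : Prop :=
  (x ℓ = b ∧ ∃ j, x j = b + 1 ∧ σ j < σ ℓ) ∨ (x ℓ = b + 1 ∧ ∃ j, x j = b ∧ σ j < σ ℓ)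

/-- Distance between the `ℓ`-th stirring and the `ℓ`-th independent particle. -/
def discrepancy {n : ℕ} (c : (Fin n → ℤ) × (Fin n → ℤ)) (ℓ : Fin n) : ℤ := c.1 ℓ - c.2 ℓ

/-- Both particles attempt the same jump, and suppression amounts to clamping to the box, which does
not increase distances. -/
theorem abs_discrepancy_le_of_not_collides {N n : ℕ} {σ : Equiv.Perm (Fin n)}
    {c : (Fin n → ℤ) × (Fin n → ℤ)} (hc : Admissible N c) {ℓ : Fin n} {b : ℤ}
    (h : ¬ Collides σ c.1 ℓ b) (a : Bool) :
    |discrepancy (couplingStep N σ c (b, a)) ℓ| ≤ |discrepancy c ℓ| := by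
  obtain ⟨x, z⟩ := c
  obtain ⟨hx, hxb, hzb⟩ := hc
  have hxl := hxb ℓ
  have hzl := hzb ℓ
  simp only [Collides, not_or, not_and] at h
  obtain ⟨h1, h2⟩ := h
  simp only [discrepancy, couplingStep, independentStep_apply hx hzb]
  unfold InBox at hxl hzl
  dsimp only at *
  cases a
  · have hJ : attemptedJump σ b false x ℓ = 0 := by
      unfold attemptedJump
      by_cases hb : x ℓ = b
      · rw [if_pos hb, if_neg (h1 hb)]
        rfl
      · by_cases hb1 : x ℓ = b + 1
        · rw [if_neg hb, if_pos hb1, if_neg (h2 hb1)]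
          rfl
        · rw [if_neg hb, if_neg hb1]
    rw [stirringStep_false, hJ]
    simp
  · have hJ : attemptedJump σ b true x ℓ
        = if x ℓ = b then 1 else if x ℓ = b + 1 then -1 else 0 := by
      unfold attemptedJump
      by_cases hb : x ℓ = b
      · rw [if_pos hb, if_pos hb, if_neg (h1 hb), if_pos rfl]
      · by_cases hb1 : x ℓ = b + 1
        · rw [if_neg hb, if_pos hb1, if_neg hb, if_pos hb1, if_neg (h2 hb1), if_pos rfl]
        · simp [hb, hb1]
    rw [stirringStep_true, hJ]
    dsimp only
    rw [exchange_eq (hxb ℓ), abs_le]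
    rcases abs_cases (x ℓ - z ℓ) with ⟨he, _⟩ | ⟨he, _⟩ <;> rw [he] <;> split_ifs <;> omega

/-- Here `δ` is the jump of the stirring particle, which is never suppressed since its target is
occupied. If the jump of the independent particle is suppressed, it would have led away from the
stirring one, so the bound persists as an inequality. -/
theorem abs_discrepancy_le_of_collides {N n : ℕ} {σ : Equiv.Perm (Fin n)}
    {c : (Fin n → ℤ) × (Fin n → ℤ)} (hc : Admissible N c) {ℓ : Fin n} {b : ℤ}
    (h : Collides σ c.1 ℓ b) :
    ∃ δ : ℤ, (δ = 1 ∨ δ = -1) ∧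
      |discrepancy (couplingStep N σ c (b, true)) ℓ| ≤ |discrepancy c ℓ + δ| ∧
      |discrepancy (couplingStep N σ c (b, false)) ℓ| ≤ |discrepancy c ℓ - δ| := by
  obtain ⟨x, z⟩ := c
  obtain ⟨hx, hxb, hzb⟩ := hc
  have hxl := hxb ℓ
  have hzl := hzb ℓ
  simp only [discrepancy, couplingStep, independentStep_apply hx hzb]
  rw [stirringStep_false, stirringStep_true]
  dsimp only at *
  rw [exchange_eq hxl]
  unfold InBox at hxl hzl
  rcases h with ⟨hb, j, hj, hlt⟩ | ⟨hb, j, hj, hlt⟩ 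
  · have hjb := hxb j
    unfold InBox at hjb
    have hJ : ∀ a, attemptedJump σ b a x ℓ = if a = false then 1 else 0 := by
      intro a
      unfold attemptedJump
      rw [if_pos hb, if_pos ⟨j, hj, hlt⟩]
    rw [hJ, hJ]
    refine ⟨1, Or.inl rfl, le_of_eq ?_, ?_⟩
    · congr 1
      simp only [Bool.true_eq_false, if_false]
      split_ifs <;> omega
    · simp only [if_true]
      rw [abs_le]
      rcases abs_cases (x ℓ - z ℓ - 1) with ⟨he, _⟩ | ⟨he, _⟩ <;> rw [he] <;> split_ifs <;> omega
  · have hjb := hxb j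
    unfold InBox at hjb
    have hne : ¬ x ℓ = b := by omega
    have hJ : ∀ a, attemptedJump σ b a x ℓ = if a = false then -1 else 0 := by
      intro a
      unfold attemptedJump
      rw [if_neg hne, if_pos hb, if_pos ⟨j, hj, hlt⟩]
    rw [hJ, hJ]
    refine ⟨-1, Or.inr rfl, le_of_eq ?_, ?_⟩
    · congr 1
      simp only [Bool.true_eq_false, if_false]
      split_ifs <;> omega
    · simp only [if_true]
      rw [abs_le]
      rcases abs_cases (x ℓ - z ℓ - -1) with ⟨he, _⟩ | ⟨he, _⟩ <;> rw [he] <;> split_ifs <;> omega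

/-- The exchange merely permutes labels, and the potential is symmetric. Hence a colliding mark
changes only the `cosh` factor of `lyapunov`. -/
theorem potential_exchange_of_adjacent {N n : ℕ} {x : Fin n → ℤ} (hx : Function.Injective x)
    (hxb : ∀ i, InBox N (x i)) {i j : Fin n} {b : ℤ} (hi : x i = b) (hj : x j = b + 1) :
    potential N (fun m => exchange N b (x m)) = potential N x := by
  have h : ∀ m, exchange N b (x m) = x (Equiv.swap i j m) := by
    intro m
    have h1 := hxb i
    have h2 := hxb j
    unfold InBox at h1 h2
    unfold exchange
    rw [if_pos (by omega), Equiv.swap_apply_def, Equiv.swap_apply_def, ← hj, ← hi]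
    by_cases hmi : m = i
    · simp [hmi]
    · by_cases hmj : m = j
      · subst hmj
        have : x m ≠ x i := fun h => hmi (hx h)
        simp [hmi, this]
      · simp [hmi, hmj, hx.ne hmi, hx.ne hmj]
  simp only [h]
  exact potential_comp_perm N x _

theorem Collides.exists_adjacent {n : ℕ} {σ : Equiv.Perm (Fin n)} {x : Fin n → ℤ} {ℓ : Fin n}
    {b : ℤ} (h : Collides σ x ℓ b) : ∃ i j, x i = b ∧ x j = b + 1 := by
  rcases h with ⟨hb, j, hj, _⟩ | ⟨hb, j, hj, _⟩
  · exact ⟨ℓ, j, hb, hj⟩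
  · exact ⟨j, ℓ, hj, hb⟩

/-! ### One-step estimate for the Lyapunov function -/

/-- The supermartingale, up to a constant factor in each step, that controls the discrepancy. -/
noncomputable def lyapunov (N : ℕ) {n : ℕ} (lam α : ℝ) (ℓ : Fin n)
    (c : (Fin n → ℤ) × (Fin n → ℤ)) : ℝ :=
  Real.cosh (lam * discrepancy c ℓ) * Real.exp (-(α * potential N c.1))

theorem cosh_mul_le_of_abs_le (lam : ℝ) {m k : ℤ} (h : |m| ≤ |k|) :
    Real.cosh (lam * m) ≤ Real.cosh (lam * k) := by
  rw [Real.cosh_le_cosh, abs_mul, abs_mul]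
  have : |(m : ℝ)| ≤ |(k : ℝ)| := by exact_mod_cast h
  gcongr

-- At a collision the two attributes average to a factor cosh λ, since cosh(λ(D+1)) + cosh(λ(D-1)) =
-- 2 cosh λ cosh(λD). Otherwise the `cosh` factor does not grow; the last term is then a harmless
-- surplus.
open Classical in
theorem sum_lyapunov_le {N n : ℕ} {σ : Equiv.Perm (Fin n)} {c : (Fin n → ℤ) × (Fin n → ℤ)}
    (hc : Admissible N c) (lam α : ℝ) (ℓ : Fin n) (b : ℤ) :
    lyapunov N lam α ℓ (couplingStep N σ c (b, true))
        + lyapunov N lam α ℓ (couplingStep N σ c (b, false))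
      ≤ Real.cosh (lam * discrepancy c ℓ) *
        (Real.exp (-(α * potential N fun i => exchange N b (c.1 i)))
          + Real.exp (-(α * potential N c.1))
          + 2 * (Real.cosh lam - 1) * Real.exp (-(α * potential N c.1)) *
            (if ∃ i j, c.1 i = b ∧ c.1 j = b + 1 then 1 else 0)) := by
  have e1 : (couplingStep N σ c (b, true)).1 = fun i => exchange N b (c.1 i) :=
    stirringStep_true N b c.1
  have e2 : (couplingStep N σ c (b, false)).1 = c.1 := stirringStep_false N b c.1
  unfold lyapunov
  rw [e1, e2]
  have hcosh : 0 ≤ Real.cosh lam - 1 := sub_nonneg.2 (Real.one_le_cosh _)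
  by_cases h : Collides σ c.1 ℓ b
  · obtain ⟨i, j, hi, hj⟩ := h.exists_adjacent
    rw [if_pos ⟨i, j, hi, hj⟩, potential_exchange_of_adjacent hc.injective hc.stirring_inBox hi hj]
    obtain ⟨δ, hδ, h1, h2⟩ := abs_discrepancy_le_of_collides hc h
    have h1' := cosh_mul_le_of_abs_le lam h1
    have h2' := cosh_mul_le_of_abs_le lam h2
    have hsum : Real.cosh (lam * ((discrepancy c ℓ + δ : ℤ) : ℝ))
        + Real.cosh (lam * ((discrepancy c ℓ - δ : ℤ) : ℝ))
        = 2 * Real.cosh lam * Real.cosh (lam * discrepancy c ℓ) := by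
      push_cast
      rw [mul_add, mul_sub, Real.cosh_add, Real.cosh_sub]
      rcases hδ with rfl | rfl
      · push_cast
        rw [mul_one]
        ring
      · push_cast
        rw [mul_neg, mul_one, Real.cosh_neg]
        ring
    have hE := Real.exp_pos (-(α * potential N c.1))
    nlinarith
  · have h1 := cosh_mul_le_of_abs_le lam (abs_discrepancy_le_of_not_collides hc h true)
    have h2 := cosh_mul_le_of_abs_le lam (abs_discrepancy_le_of_not_collides hc h false)
    have hrest : 0 ≤ 2 * (Real.cosh lam - 1) * Real.exp (-(α * potential N c.1)) *
        (if ∃ i j, c.1 i = b ∧ c.1 j = b + 1 then (1 : ℝ) else 0) := by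
      have : (0 : ℝ) ≤ if ∃ i j, c.1 i = b ∧ c.1 j = b + 1 then 1 else 0 := by
        split_ifs <;> norm_num
      positivity
    have hC := Real.cosh_pos (lam * discrepancy c ℓ)
    rw [mul_add, mul_add]
    refine le_add_of_le_of_nonneg (add_le_add ?_ ?_) (mul_nonneg hC.le hrest)
    · gcongr
    · gcongr

open Classical in
theorem sum_exists_adjacent_le (N : ℕ) {n : ℕ} (x : Fin n → ℤ) :
    ∑ b ∈ bonds N, (if ∃ i j, x i = b ∧ x j = b + 1 then (1 : ℝ) else 0) ≤ adjacentPairs x := by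
  calc _ ≤ ∑ b ∈ bonds N, ∑ i, ∑ j, (if b = x i then if x j = x i + 1 then (1 : ℝ) else 0 else 0) := by
        refine Finset.sum_le_sum fun b _ => ?_
        have hnn : ∀ i j, (0 : ℝ) ≤ if b = x i then if x j = x i + 1 then 1 else 0 else 0 := by
          intro i j
          split_ifs <;> norm_num
        split_ifs with h
        · obtain ⟨i, j, hi, hj⟩ := h
          refine le_trans ?_ (Finset.single_le_sum (fun i _ => Finset.sum_nonneg fun j _ => hnn i j)
            (Finset.mem_univ i))
          refine le_trans ?_ (Finset.single_le_sum (fun j _ => hnn i j) (Finset.mem_univ j))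
          rw [if_pos hi.symm, if_pos (by omega)]
        · exact Finset.sum_nonneg fun i _ => Finset.sum_nonneg fun j _ => hnn i j
    _ = ∑ i, ∑ j, ∑ b ∈ bonds N, (if b = x i then if x j = x i + 1 then (1 : ℝ) else 0 else 0) := by
        rw [Finset.sum_comm]
        exact Finset.sum_congr rfl fun i _ => Finset.sum_comm
    _ ≤ adjacentPairs x := by
        refine Finset.sum_le_sum fun i _ => Finset.sum_le_sum fun j _ => ?_
        rw [Finset.sum_ite_eq']
        split_ifs <;> norm_num

theorem sum_exp_potential_exchange_le {N : ℕ} (hN : 0 < N) {n : ℕ} {x : Fin n → ℤ}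
    (hx : ∀ i, InBox N (x i)) {α : ℝ} (hα0 : 0 ≤ α) (hα : α * (6 * (n : ℝ) ^ 2) ≤ 1) :
    ∑ b ∈ bonds N, Real.exp (-(α * potential N fun i => exchange N b (x i)))
      ≤ Real.exp (-(α * potential N x)) * ((bonds N).card - 2 * α * adjacentPairs x
          + 4 * (n : ℝ) ^ 2 * α / N + 72 * (n : ℝ) ^ 4 * α ^ 2) := by
  set Δ : ℤ → ℝ := fun b => potential N (fun i => exchange N b (x i)) - potential N x with hΔ
  -- `hα` and the uniform bound on `Δ` put the exponent in [-1, 1], where exp(-y) ≤ 1 - y + y².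
  have hb : ∀ b, Real.exp (-(α * Δ b)) ≤ 1 - α * Δ b + α ^ 2 * Δ b ^ 2 := by
    intro b
    have h1 : |-(α * Δ b)| ≤ 1 := by
      rw [abs_neg, abs_mul, abs_of_nonneg hα0]
      exact (mul_le_mul_of_nonneg_left (abs_potential_exchange_sub_le hN hx b) hα0).trans hα
    have h2 := (abs_le.1 (Real.abs_exp_sub_one_sub_id_le h1)).2
    nlinarith
  calc _ = Real.exp (-(α * potential N x)) * ∑ b ∈ bonds N, Real.exp (-(α * Δ b)) := by
        rw [Finset.mul_sum]
        refine Finset.sum_congr rfl fun b _ => ?_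
        rw [← Real.exp_add]
        congr 1
        simp only [hΔ]
        ring
    _ ≤ Real.exp (-(α * potential N x)) * ∑ b ∈ bonds N, (1 - α * Δ b + α ^ 2 * Δ b ^ 2) := by
        gcongr with b
        exact hb b
    _ ≤ _ := by
        gcongr
        rw [Finset.sum_add_distrib, Finset.sum_sub_distrib, ← Finset.mul_sum, ← Finset.mul_sum]
        simp only [Finset.sum_const, nsmul_eq_mul, mul_one]
        have h1 := mul_le_mul_of_nonneg_left (le_sum_potential_exchange_sub hN hx) hα0
        have h2 := mul_le_mul_of_nonneg_left (sum_potential_exchange_sub_sq_le hN hx) (sq_nonneg α)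
        have h3 : α * (2 * adjacentPairs x - 4 * (n : ℝ) ^ 2 / N)
            = 2 * α * adjacentPairs x - 4 * (n : ℝ) ^ 2 * α / N := by ring
        rw [h3] at h1
        linarith

theorem sum_letters (N : ℕ) (f : ℤ × Bool → ℝ) :
    ∑ l ∈ letters N, f l = ∑ b ∈ bonds N, (f (b, true) + f (b, false)) := by
  rw [letters, Finset.sum_product]
  exact Finset.sum_congr rfl fun b _ => Fintype.sum_bool _

/-- By `hlam`, the collisions gain at most 2α per neighbouring pair, exactly what the drift of the
potential loses. Only the wall correction and the second-order term survive. -/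
theorem sum_letters_lyapunov_le {N : ℕ} (hN : 0 < N) {n : ℕ} {σ : Equiv.Perm (Fin n)}
    {lam α : ℝ} (hα0 : 0 ≤ α) (hα : α * (6 * (n : ℝ) ^ 2) ≤ 1) (hlam : Real.cosh lam - 1 ≤ α)
    (ℓ : Fin n) {c : (Fin n → ℤ) × (Fin n → ℤ)} (hc : Admissible N c) :
    ∑ l ∈ letters N, lyapunov N lam α ℓ (couplingStep N σ c l)
      ≤ (2 * (bonds N).card + 2 * (2 * (n : ℝ) ^ 2 * α / N + 36 * (n : ℝ) ^ 4 * α ^ 2)) *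
        lyapunov N lam α ℓ c := by
  classical
  have hcosh : 0 ≤ Real.cosh lam - 1 := sub_nonneg.2 (Real.one_le_cosh _)
  have hA : 0 ≤ adjacentPairs c.1 :=
    Finset.sum_nonneg fun i _ => Finset.sum_nonneg fun j _ => by split_ifs <;> norm_num
  rw [sum_letters]
  refine (Finset.sum_le_sum fun b _ => sum_lyapunov_le hc lam α ℓ b).trans ?_
  rw [← Finset.mul_sum, Finset.sum_add_distrib, Finset.sum_add_distrib, ← Finset.mul_sum,
    Finset.sum_const, nsmul_eq_mul]
  unfold lyapunov
  have hC := Real.cosh_pos (lam * discrepancy c ℓ)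
  rw [mul_left_comm]
  refine mul_le_mul_of_nonneg_left ?_ hC.le
  have h1 := sum_exp_potential_exchange_le hN hc.stirring_inBox hα0 hα
  set E := Real.exp (-(α * potential N c.1))
  have hE : 0 < E := Real.exp_pos _
  have h2 : 2 * (Real.cosh lam - 1) * E *
      ∑ b ∈ bonds N, (if ∃ i j, c.1 i = b ∧ c.1 j = b + 1 then (1 : ℝ) else 0)
      ≤ 2 * α * E * adjacentPairs c.1 := by
    have := sum_exists_adjacent_le N c.1
    gcongr
  refine (add_le_add (add_le_add h1 le_rfl) h2).trans (le_of_eq ?_)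
  ring

/-! ### Displacement of a stirring particle and the tail bound -/

/-- Exponential moment of the displacement of a single stirring particle. -/
theorem sum_letters_cosh_le {N n : ℕ} {σ : Equiv.Perm (Fin n)} (α : ℝ) (i : Fin n) {p : ℤ}
    (hp : InBox N p) {c : (Fin n → ℤ) × (Fin n → ℤ)} (hc : Admissible N c) :
    ∑ l ∈ letters N, Real.cosh (α * (((couplingStep N σ c l).1 i : ℝ) - p))
      ≤ (2 * (bonds N).card + 2 * (Real.cosh α - 1)) * Real.cosh (α * ((c.1 i : ℝ) - p)) := by
  have e1 : ∀ b, (couplingStep N σ c (b, true)).1 i = exchange N b (c.1 i) :=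
    fun b => congrFun (stirringStep_true N b c.1) i
  have e2 : ∀ b, (couplingStep N σ c (b, false)).1 i = c.1 i :=
    fun b => congrFun (stirringStep_false N b c.1) i
  rw [sum_letters]
  simp only [e1, e2]
  set q := c.1 i
  have hq : InBox N q := hc.stirring_inBox i
  set C := Real.cosh (α * ((q : ℝ) - p))
  have hC : 0 < C := Real.cosh_pos _
  have hcosh : 0 ≤ Real.cosh α - 1 := sub_nonneg.2 (Real.one_le_cosh _)
  set u : ℝ := if q < N then Real.cosh (α * ((q : ℝ) + 1 - p)) - C else 0 with hu
  set v : ℝ := if -(N : ℤ) < q then Real.cosh (α * ((q : ℝ) - 1 - p)) - C else 0 with hv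
  have hstep : ∀ b ∈ bonds N, Real.cosh (α * ((exchange N b q : ℝ) - p)) + C
      = 2 * C + ((if b = q then u else 0) + (if b = q - 1 then v else 0)) := by
    intro b _
    rw [exchange_eq hq]
    by_cases h1 : b = q
    · have h2 : ¬ b = q - 1 := by omega
      rw [if_pos h1, if_pos h1, if_neg h2, if_neg h2, hu]
      split_ifs
      · push_cast
        rw [sub_zero]
        ring
      · push_cast
        rw [sub_zero, add_zero]
        ring
    · rw [if_neg h1, if_neg h1]
      by_cases h2 : b = q - 1
      · rw [if_pos h2, if_pos h2, hv]
        split_ifs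
        · push_cast
          rw [add_zero]
          ring
        · push_cast
          rw [sub_zero, add_zero]
          ring
      · rw [if_neg h2, if_neg h2]
        push_cast
        rw [sub_zero, add_zero]
        ring
  rw [Finset.sum_congr rfl hstep, Finset.sum_add_distrib, sum_bonds_ite hq, Finset.sum_const,
    nsmul_eq_mul]
  have c1 : Real.cosh (α * ((q : ℝ) + 1 - p))
      = C * Real.cosh α + Real.sinh (α * ((q : ℝ) - p)) * Real.sinh α := by
    rw [← Real.cosh_add]
    congr 1
    ring
  have c2 : Real.cosh (α * ((q : ℝ) - 1 - p))
      = C * Real.cosh α - Real.sinh (α * ((q : ℝ) - p)) * Real.sinh α := by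
    rw [← Real.cosh_sub]
    congr 1
    ring
  have hsinh : ∀ d : ℝ, 0 ≤ d → 0 ≤ Real.sinh (α * d) * Real.sinh α := by
    intro d hd
    rcases le_total 0 α with h | h
    · exact mul_nonneg (Real.sinh_nonneg_iff.2 (by positivity)) (Real.sinh_nonneg_iff.2 h)
    · exact mul_nonneg_of_nonpos_of_nonpos (Real.sinh_nonpos_iff.2 (by nlinarith))
        (Real.sinh_nonpos_iff.2 h)
  have huv : u + v ≤ 2 * (Real.cosh α - 1) * C := by
    rw [hu, hv]
    have hCc := mul_nonneg hcosh hC.le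
    by_cases h1 : q < N <;> by_cases h2 : -(N : ℤ) < q
    · rw [if_pos h1, if_pos h2, c1, c2]
      linarith
    · rw [if_pos h1, if_neg h2, c1]
      -- At the left wall the missing move would have led away from `p`; the remaining one
      -- contributes a nonpositive `sinh` product.
      have h3 : (q : ℝ) ≤ p := by
        unfold InBox at hp
        exact_mod_cast (by omega : q ≤ p)
      have h4 := hsinh (p - q) (by linarith)
      rw [show α * ((p : ℝ) - q) = -(α * (q - p)) by ring, Real.sinh_neg] at h4
      linarith
    · rw [if_neg h1, if_pos h2, c2]
      have h3 : (p : ℝ) ≤ q := by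
        unfold InBox at hp
        exact_mod_cast (by omega : p ≤ q)
      have h4 := hsinh (q - p) (by linarith)
      linarith
    · rw [if_neg h1, if_neg h2]
      linarith
  nlinarith

theorem cosh_sub_one_le_sq {x : ℝ} (hx : x ^ 2 ≤ 1) : Real.cosh x - 1 ≤ x ^ 2 := by
  have h1 := Real.cosh_le_exp_half_sq x
  have h2 : |x ^ 2 / 2| ≤ 1 := by
    rw [abs_of_nonneg (by positivity)]
    linarith
  have h3 := (abs_le.1 (Real.abs_exp_sub_one_sub_id_le h2)).2
  nlinarith [sq_nonneg x]

theorem exp_div_two_le_cosh_of_le_abs {u v : ℝ} (h : u ≤ |v|) : Real.exp u / 2 ≤ Real.cosh v := by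
  rw [← Real.cosh_abs, Real.cosh_eq]
  have := Real.exp_le_exp.2 h
  have := Real.exp_pos (-|v|)
  linarith

/-- A large discrepancy forces a large value of `lyapunov` or a large displacement of some
stirring particle. -/
theorem le_lyapunov_or_le_cosh {N : ℕ} (hN : 0 < N) {n : ℕ} (hn : 0 < n) {ℓ : Fin n} {lam α : ℝ}
    (hlam : 0 ≤ lam) (hα : 0 ≤ α) {x : Fin n → ℤ} (hx : ∀ i, InBox N (x i))
    {c : (Fin n → ℤ) × (Fin n → ℤ)} (hc : Admissible N c) {A : ℝ}
    (hA : A ≤ |(c.1 ℓ : ℝ) - c.2 ℓ|) :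
    Real.exp (lam * A / 2) / 2 * Real.exp (-(α * potential N x)) ≤ lyapunov N lam α ℓ c ∨
      ∃ i, Real.exp (lam * A / (12 * (n : ℝ) ^ 2)) / 2
        ≤ Real.cosh (α * ((c.1 i : ℝ) - x i)) := by
  have hn' : (0 : ℝ) < n := by exact_mod_cast hn
  -- The threshold is chosen so that, if no particle exceeds it, α times the change of the potential
  -- is at most 6n · n · λA/(12n²) = λA/2, half of the exponent gained from the gap.
  by_cases h : ∃ i, lam * A / (12 * (n : ℝ) ^ 2) ≤ |α * ((c.1 i : ℝ) - x i)|
  · obtain ⟨i, hi⟩ := h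
    exact Or.inr ⟨i, exp_div_two_le_cosh_of_le_abs hi⟩
  · left
    push Not at h
    have hU := mul_le_mul_of_nonneg_left (abs_potential_sub_le hN hx hc.stirring_inBox) hα
    have hsum : ∑ i, |α * ((c.1 i : ℝ) - x i)| ≤ n * (lam * A / (12 * (n : ℝ) ^ 2)) := by
      refine (Finset.sum_le_sum fun i _ => (h i).le).trans (le_of_eq ?_)
      simp
    have hsum' : ∑ i, |α * ((c.1 i : ℝ) - x i)| = α * ∑ i, |(c.1 i : ℝ) - x i| := by
      rw [Finset.mul_sum]
      refine Finset.sum_congr rfl fun i _ => ?_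
      rw [abs_mul, abs_of_nonneg hα]
    have hU' : α * |potential N c.1 - potential N x| ≤ lam * A / 2 := by
      calc _ ≤ 6 * n * (α * ∑ i, |(c.1 i : ℝ) - x i|) := by linarith
        _ ≤ 6 * n * (n * (lam * A / (12 * (n : ℝ) ^ 2))) := by
            rw [← hsum']
            gcongr
        _ = _ := by
            field_simp
            ring
    have hD : Real.exp (lam * A) / 2 ≤ Real.cosh (lam * discrepancy c ℓ) := by
      refine exp_div_two_le_cosh_of_le_abs ?_
      rw [abs_mul, abs_of_nonneg hlam]
      unfold discrepancy
      push_cast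
      gcongr
    have hE : Real.exp (-(lam * A / 2)) * Real.exp (-(α * potential N x))
        ≤ Real.exp (-(α * potential N c.1)) := by
      rw [← Real.exp_add, Real.exp_le_exp]
      have := mul_le_mul_of_nonneg_left (le_abs_self (potential N c.1 - potential N x)) hα
      linarith
    calc _ = Real.exp (lam * A) / 2 *
          (Real.exp (-(lam * A / 2)) * Real.exp (-(α * potential N x))) := by
          have he : Real.exp (lam * A / 2) = Real.exp (lam * A) * Real.exp (-(lam * A / 2)) := by
            rw [← Real.exp_add]
            congr 1
            ring
          rw [he]
          ring
      _ ≤ _ := mul_le_mul hD hE (by positivity) (Real.cosh_pos _).le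

/-- Tail bound for the discrepancy with free parameters. -/
theorem marksLaw_discrepancy_le {N : ℕ} (hN : 0 < N) {n : ℕ} (hn : 0 < n) (σ : Equiv.Perm (Fin n))
    {x : Fin n → ℤ} (hx : Function.Injective x) (hxb : ∀ i, InBox N (x i)) (ℓ : Fin n)
    {r : ℝ} (hr : 0 < r) {t : ℝ} (ht : 0 ≤ t) {lam α A : ℝ} (hlam0 : 0 ≤ lam) (hα0 : 0 ≤ α)
    (hα : α * (6 * (n : ℝ) ^ 2) ≤ 1) (hlam : lam ^ 2 = α) (hA : 0 < A) :
    marksLaw r {ω | A ≤ |(stirringPosition N σ x x ω t ℓ : ℝ)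
        - (independentPosition N σ x x ω t ℓ : ℝ)|}
      ≤ ENNReal.ofReal (2 * Real.exp ((2 * (n : ℝ) ^ 2 * α / N + 36 * (n : ℝ) ^ 4 * α ^ 2) * (r * t))
          * Real.exp (-(lam * A / 2))
        + n * (2 * Real.exp (α ^ 2 * (r * t)) * Real.exp (-(lam * A / (12 * (n : ℝ) ^ 2))))) := by
  have hn1 : (1 : ℝ) ≤ n := by exact_mod_cast hn
  have hα1 : α ≤ 1 := by nlinarith [mul_nonneg hα0 (sub_nonneg.2 (one_le_pow₀ hn1 (n := 2)))]
  have hαsq : α ^ 2 ≤ 1 := pow_le_one₀ hα0 hα1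
  have hcosh : Real.cosh lam - 1 ≤ α := hlam ▸ cosh_sub_one_le_sq (hlam ▸ hα1)
  have hinit : Admissible N (x, x) := ⟨hx, hxb, hxb⟩
  have hstep : ∀ c l, Admissible N c → Admissible N (couplingStep N σ c l) :=
    fun c l hc => hc.couplingStep l
  have hfold : ∀ w : List (ℤ × Bool), Admissible N (w.foldl (couplingStep N σ) (x, x)) := by
    intro w
    refine List.foldlRecOn w (couplingStep N σ) hinit fun c hc l _ => hstep c l hc
  set κ := 2 * (n : ℝ) ^ 2 * α / N + 36 * (n : ℝ) ^ 4 * α ^ 2 with hκ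
  have hκ0 : 0 ≤ κ := by positivity
  set θ := Real.exp (lam * A / 2) / 2 * Real.exp (-(α * potential N x)) with hθ
  set η := Real.exp (lam * A / (12 * (n : ℝ) ^ 2)) / 2 with hη
  have b1 := marksLaw_le_foldl_le hr ht N (couplingStep N σ) (Admissible N) hstep
    (lyapunov N lam α ℓ) (fun c => mul_nonneg (Real.cosh_pos _).le (Real.exp_pos _).le) hκ0
    (fun c hc => sum_letters_lyapunov_le hN hα0 hα hcosh ℓ hc) hinit
    (θ := θ) (by positivity)
  have b2 := fun i => marksLaw_le_foldl_le hr ht N (couplingStep N σ) (Admissible N) hstep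
    (fun c => Real.cosh (α * ((c.1 i : ℝ) - x i))) (fun c => (Real.cosh_pos _).le)
    (sub_nonneg.2 (Real.one_le_cosh α))
    (fun c hc => sum_letters_cosh_le α i (hxb i) hc) hinit (θ := η) (by positivity)
  have v1 : Real.exp (κ * (r * t)) * lyapunov N lam α ℓ (x, x) / θ
      = 2 * Real.exp (κ * (r * t)) * Real.exp (-(lam * A / 2)) := by
    simp only [lyapunov, discrepancy, sub_self, Int.cast_zero, mul_zero, Real.cosh_zero, one_mul, hθ]
    rw [Real.exp_neg (lam * A / 2)]
    field_simp
  have v2 : ∀ i : Fin n, Real.exp ((Real.cosh α - 1) * (r * t)) *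
        Real.cosh (α * ((x i : ℝ) - x i)) / η
      ≤ 2 * Real.exp (α ^ 2 * (r * t)) * Real.exp (-(lam * A / (12 * (n : ℝ) ^ 2))) := by
    intro i
    have h1 : Real.exp ((Real.cosh α - 1) * (r * t)) ≤ Real.exp (α ^ 2 * (r * t)) := by
      rw [Real.exp_le_exp]
      have := cosh_sub_one_le_sq hαsq
      gcongr
    rw [sub_self, mul_zero, Real.cosh_zero, mul_one, hη, Real.exp_neg]
    calc _ ≤ Real.exp (α ^ 2 * (r * t)) / (Real.exp (lam * A / (12 * (n : ℝ) ^ 2)) / 2) := by gcongr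
      _ = _ := by rw [div_div_eq_mul_div, mul_comm (Real.exp _) 2, div_eq_mul_inv]
  calc _ ≤ marksLaw r ({ω | ∀ p, 0 < (ω p).1}ᶜ ∪
        ({ω | (∀ p, 0 < (ω p).1) ∧ (marksUpTo N ω t).Finite ∧ θ ≤ lyapunov N lam α ℓ
            ((chronologicalMarks N ω t).foldl (couplingStep N σ) (x, x))} ∪
          ⋃ i ∈ (Finset.univ : Finset (Fin n)),
            {ω | (∀ p, 0 < (ω p).1) ∧ (marksUpTo N ω t).Finite ∧ η ≤
              Real.cosh (α * ((((chronologicalMarks N ω t).foldl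
                (couplingStep N σ) (x, x)).1 i : ℝ) - x i))})) := by
        refine measure_mono fun ω hω => ?_
        by_cases hpos : ∀ p, 0 < (ω p).1
        · right
          by_cases hfin : (marksUpTo N ω t).Finite
          · rcases le_lyapunov_or_le_cosh hN hn hlam0 hα0 hxb
              (hfold (chronologicalMarks N ω t)) hω with h | ⟨i, h⟩
            · exact Or.inl ⟨hpos, hfin, h⟩
            · exact Or.inr (Set.mem_biUnion (Finset.mem_coe.2 (Finset.mem_univ i)) ⟨hpos, hfin, h⟩)
          -- With infinitely many marks the list is `[]` by convention, so the gap is 0 < `A`;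
          -- almost sure finiteness is never needed.
          · exfalso
            have hnil : chronologicalMarks N ω t = [] := dif_neg hfin
            have hle : A ≤ |(stirringPosition N σ x x ω t ℓ : ℝ)
              - (independentPosition N σ x x ω t ℓ : ℝ)| := hω
            simp only [stirringPosition, independentPosition, coupledProcess, hnil, List.foldl_nil,
              sub_self, abs_zero] at hle
            linarith
        · exact Or.inl hpos
    _ ≤ 0 + (ENNReal.ofReal (2 * Real.exp (κ * (r * t)) * Real.exp (-(lam * A / 2))) +
          ∑ _i : Fin n, ENNReal.ofReal (2 * Real.exp (α ^ 2 * (r * t)) *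
            Real.exp (-(lam * A / (12 * (n : ℝ) ^ 2))))) := by
        refine (measure_union_le _ _).trans (add_le_add (le_of_eq (ae_pos_waitingTime hr)) ?_)
        refine (measure_union_le _ _).trans (add_le_add (b1.trans_eq (by rw [v1])) ?_)
        refine (measure_biUnion_finset_le _ _).trans (Finset.sum_le_sum fun i _ => ?_)
        exact (b2 i).trans (ENNReal.ofReal_le_ofReal (v2 i))
    _ = _ := by
        rw [zero_add, Finset.sum_const, Finset.card_univ, Fintype.card_fin, nsmul_eq_mul,
          ENNReal.ofReal_add (by positivity) (by positivity), ENNReal.ofReal_mul (p := (n : ℝ))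
          (by positivity), ENNReal.ofReal_natCast]

/-! ### Choice of the parameters -/

/-- One term y^p/p! of the exponential series suffices, with p large enough that pζ ≥ k. -/
theorem exp_neg_mul_rpow_le {M ζ h : ℝ} (hM : 1 ≤ M) (hζ : 0 < ζ) (hh : 0 < h) (k : ℕ) :
    Real.exp (-(h * M ^ ζ)) ≤
      (⌈k / ζ⌉₊.factorial / h ^ ⌈k / ζ⌉₊ : ℝ) * M ^ (-(k : ℤ)) := by
  set p := ⌈k / ζ⌉₊
  have hM0 : 0 < M := by linarith
  have h1 : M ^ k ≤ (M ^ ζ) ^ p := by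
    rw [← Real.rpow_natCast, ← Real.rpow_natCast, ← Real.rpow_mul hM0.le]
    refine Real.rpow_le_rpow_of_exponent_le hM ?_
    have : (k : ℝ) / ζ ≤ p := Nat.le_ceil _
    rw [div_le_iff₀ hζ] at this
    linarith
  have h2 := Real.pow_div_factorial_le_exp (x := h * M ^ ζ) (by positivity) p
  rw [Real.exp_neg, zpow_neg, zpow_natCast, ← div_eq_mul_inv, div_div,
    inv_le_comm₀ (Real.exp_pos _) (by positivity), inv_div]
  refine le_trans ?_ h2
  rw [mul_pow]
  gcongr

theorem theorem4p5 (n : ℕ) (T : ℝ) (hT : 0 < T) (ζ : ℝ) (hζ : 0 < ζ) (k : ℕ) :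
    ∃ c : ℝ, ∀ (N : ℕ) (ε : ℝ), 0 < N → ε = 1 / (N : ℝ) →
      ∀ (σ : Equiv.Perm (Fin n)) (x x₀ : Fin n → ℤ),
        Function.Injective x → (∀ i, -(N : ℤ) ≤ x i ∧ x i ≤ N) → x = x₀ →
        ∀ (ℓ : Fin n) (t : ℝ), 0 < t → t ≤ T →
          (marksLaw (ε ^ (-2 : ℤ))).real
              {ω | (ε ^ (-2 : ℤ) * t) ^ (1 / 4 + ζ) ≤
                |(stirringPosition N σ x x₀ ω t ℓ : ℝ) - (independentPosition N σ x x₀ ω t ℓ : ℝ)|}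
            ≤ c * (ε ^ (-2 : ℤ) * t) ^ (-(k : ℤ)) := by
  -- The largest value of α allowed by the condition α · 6n² ≤ 1.
  set a : ℝ := 1 / (6 * (n : ℝ) ^ 2) with ha
  set h : ℝ := √a / (12 * (n : ℝ) ^ 2) with hh
  set C : ℝ := 2 * Real.exp (√T / 3 + 1) + n * (2 * Real.exp 1) with hC
  set c₁ : ℝ := C * (⌈k / ζ⌉₊.factorial / h ^ ⌈k / ζ⌉₊) with hc₁
  -- Only nonnegativity is available: for `n = 0` division by zero gives `a = h = 0`. Positivity
  -- follows once some `ℓ` is given.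
  have hh0 : 0 ≤ h := by positivity
  have hc₁0 : 0 ≤ c₁ := by positivity
  refine ⟨1 + c₁, ?_⟩
  rintro N ε hN hε σ x _ hx hxb rfl ℓ t ht htT
  have hN' : (0 : ℝ) < N := by exact_mod_cast hN
  have hr : ε ^ (-2 : ℤ) = (N : ℝ) ^ 2 := by
    rw [hε, one_div, zpow_neg, inv_zpow, inv_inv]
    rfl
  rw [hr]
  set r : ℝ := (N : ℝ) ^ 2 with hrdef
  have hr0 : 0 < r := by positivity
  have := isProbabilityMeasure_marksLaw hr0
  set M : ℝ := r * t with hM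
  have hM0 : 0 < M := by positivity
  have hpow : 0 < M ^ (-(k : ℤ)) := by positivity
  -- For M < 1 the right-hand side is at least 1; this is what the summand 1 in the constant is for.
  rcases lt_or_ge M 1 with hM1 | hM1
  · have h1 : (1 : ℝ) ≤ M ^ (-(k : ℤ)) := by
      rw [zpow_neg, zpow_natCast]
      exact (one_le_inv₀ (by positivity)).2 (pow_le_one₀ hM0.le hM1.le)
    refine measureReal_le_one.trans ?_
    nlinarith
  have hn : 0 < n := ℓ.pos
  have hn1 : (1 : ℝ) ≤ n := by exact_mod_cast hn
  have hn2 : (1 : ℝ) ≤ (n : ℝ) ^ 2 := one_le_pow₀ hn1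
  have ha0 : 0 < a := by positivity
  have han : a * (6 * (n : ℝ) ^ 2) = 1 := by
    rw [ha]
    field_simp
  have hsM : 1 ≤ √M := Real.one_le_sqrt.2 hM1
  have hsMsq : √M ^ 2 = M := Real.sq_sqrt hM0.le
  -- With this scale α²M is constant, and λ = √α is of order M^(-1/4), so that λA is a constant
  -- times M^ζ.
  set α : ℝ := a / √M with hα
  have hα0 : 0 ≤ α := by positivity
  have hαa : α ≤ a := div_le_self ha0.le hsM
  have hα6 : α * (6 * (n : ℝ) ^ 2) ≤ 1 := by
    rw [← han]
    gcongr
  have hlamA : √α * M ^ (1 / 4 + ζ) = √a * M ^ ζ := by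
    have h4 : √(√M) = M ^ (1 / 4 : ℝ) := by
      rw [Real.sqrt_eq_rpow, Real.sqrt_eq_rpow, ← Real.rpow_mul hM0.le]
      norm_num
    have : 0 < M ^ (1 / 4 : ℝ) := by positivity
    rw [hα, Real.sqrt_div ha0.le, h4, Real.rpow_add hM0]
    field_simp
  have hαM : α ^ 2 * M = a ^ 2 := by
    rw [hα, div_pow, hsMsq]
    field_simp
  have hsMN : √M = N * √t := by
    rw [hM, hrdef, Real.sqrt_mul (by positivity), Real.sqrt_sq hN'.le]
  -- The wall correction is where `T` enters: αM/N is of order √M/N = √t.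
  have hexp : (2 * (n : ℝ) ^ 2 * α / N + 36 * (n : ℝ) ^ 4 * α ^ 2) * M ≤ √T / 3 + 1 := by
    have e1 : 36 * (n : ℝ) ^ 4 * α ^ 2 * M = 1 := by
      calc _ = 36 * (n : ℝ) ^ 4 * (α ^ 2 * M) := by ring
        _ = (a * (6 * (n : ℝ) ^ 2)) ^ 2 := by rw [hαM]; ring
        _ = 1 := by rw [han, one_pow]
    have e2 : 2 * (n : ℝ) ^ 2 * α / N * M = √t / 3 := by
      have e3 : α * M = a * √M := by
        rw [hα]
        nth_rewrite 2 [← hsMsq]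
        field_simp
      calc _ = 2 * (n : ℝ) ^ 2 * (α * M) / N := by ring
        _ = (a * (6 * (n : ℝ) ^ 2)) * (√M / N) / 3 := by rw [e3]; ring
        _ = _ := by
          rw [han, hsMN]
          field_simp
    have e4 := Real.sqrt_le_sqrt htT
    rw [add_mul, e1, e2]
    linarith
  have ha1 : a ≤ 1 := by nlinarith
  have main := marksLaw_discrepancy_le hN hn σ hx hxb ℓ hr0 ht.le (Real.sqrt_nonneg α) hα0 hα6
    (Real.sq_sqrt hα0) (A := M ^ (1 / 4 + ζ)) (by positivity)
  have hbound := exp_neg_mul_rpow_le hM1 hζ (by positivity : 0 < h) k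
  refine ENNReal.toReal_le_of_le_ofReal (by positivity) (main.trans (ENNReal.ofReal_le_ofReal ?_))
  rw [hlamA, ← hM, hαM]
  have g1 : Real.exp (-(√a * M ^ ζ / (12 * (n : ℝ) ^ 2))) = Real.exp (-(h * M ^ ζ)) := by
    congr 2
    rw [hh]
    ring
  have g2 : Real.exp (-(√a * M ^ ζ / 2)) ≤ Real.exp (-(h * M ^ ζ)) := by
    rw [← g1, Real.exp_le_exp, neg_le_neg_iff]
    gcongr
    linarith
  have g3 : a ^ 2 ≤ 1 := pow_le_one₀ ha0.le ha1
  rw [g1]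
  calc _ ≤ 2 * Real.exp (√T / 3 + 1) * Real.exp (-(h * M ^ ζ))
        + n * (2 * Real.exp 1 * Real.exp (-(h * M ^ ζ))) := by gcongr
    _ = C * Real.exp (-(h * M ^ ζ)) := by
        rw [hC]
        ring
    _ ≤ C * ((⌈k / ζ⌉₊.factorial / h ^ ⌈k / ζ⌉₊ : ℝ) * M ^ (-(k : ℤ))) := by gcongr
    _ ≤ _ := by
        rw [← mul_assoc, ← hc₁]
        nlinarith
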